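/- Let $n\ge 1$, let $C=\mathbb R^n_{\ge 0}$ be the closed positive orthant, and let $B_1,\dots,B_n\subset\mathbb R^n$ be lattice polyhedra (finite intersections of closed half-spaces all of whose vertices lie in $\mathbb Z^n$) such that each symmetric difference $C\,\triangle\,B_i$ is bounded. For a pair $(A,B)$ of polyhedra with bounded symmetric difference, let $\mathrm V(A,B)=n!\,\bigl(\mathrm{vol}(A\setminus B)-\mathrm{vol}(B\setminus A)\bigr)$, where $\mathrm{vol}$ is Lebesgue measure. The relative mixed volume $\mathrm{Vol}_C(B_1,\dots,B_n)$ is the mixed volume of the pairs $(C,B_1),\dots,(C,B_n)$, i.e. the value on them of the symmetric function of $n$ pairs, multilinear with respect to componentwise Minkowski addition, that equals $\mathrm V(A,B)$ on $n$ copies of $(A,B)$; explicitly, $$\mathrm{Vol}_C(B_1,\dots,B_n)=\frac1{n!}\sum_{\emptyset\ne I\subseteq\{1,\dots,n\}}(-1)^{n-|I|}\;\mathrm V\Bigl(\sum_{i\in I}C,\ \sum_{i\in I}B_i\Bigr).$$ Suppose that the tuple $B_1,\dots,B_n$ is minimal by inclusion with mixed volume $V$: $\mathrm{Vol}_C(B_1,\dots,B_n)=V$,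 and for every $i$ and every lattice point $\delta\in(C\setminus B_i)\cap\mathbb Z^n$, replacing $B_i$ by $\mathrm{conv}(B_i\cup\{\delta\})$ gives a tuple with relative mixed volume strictly less than $V$. Then $$C_{V,\dots,V}:=\{x\in C:\ x_1+\dots+x_n\ge V\}\subseteq B_i\qquad\text{for every } i=1,\dots,n;$$ for $V>0$ this set is the closed unbounded part of $C$ cut off by the hyperplane through $V e_1,\dots,V e_n$. -/

import Mathlib

open scoped Pointwise Nat

namespace RelMixedVolume

/-- The closed positive orthant `C` of `ℝⁿ`. -/
def orthant (n : ℕ) : Set (Fin n → ℝ) := {x | ∀ i, 0 ≤ x i}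

/-- The points of the lattice `ℤⁿ` in `ℝⁿ`. -/
def IsLatticePoint {n : ℕ} (x : Fin n → ℝ) : Prop := ∀ i, ∃ z : ℤ, x i = (z : ℝ)

/-- A polyhedron: an intersection of finitely many closed half-spaces. -/
def IsPolyhedron {n : ℕ} (P : Set (Fin n → ℝ)) : Prop :=
  ∃ (m : ℕ) (ℓ : Fin m → ((Fin n → ℝ) →ₗ[ℝ] ℝ)) (c : Fin m → ℝ),
    P = {x | ∀ j, c j ≤ ℓ j x}

/-- A lattice polyhedron: all vertices (extreme points) are lattice points. -/
def IsLatticePolyhedron {n : ℕ} (P : Set (Fin n → ℝ)) : Prop :=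
  IsPolyhedron P ∧ ∀ x ∈ P.extremePoints ℝ, IsLatticePoint x

/-- The lattice volume of a pair `(A, B)`: `n!` times the difference of the Lebesgue volumes of
`A \ B` and `B \ A`. It is used for pairs with bounded symmetric difference, where both volumes
are finite. -/
noncomputable def pairVolume {n : ℕ} (A B : Set (Fin n → ℝ)) : ℝ :=
  (n ! : ℝ) * ((MeasureTheory.volume (A \ B)).toReal - (MeasureTheory.volume (B \ A)).toReal)

/-- The mixed volume of the pairs `(A i, B i)`: the full polarization of `pairVolume` with respect
to componentwise Minkowski addition. This is the value of the symmetric multilinear function of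
pairs whose value on `n` copies of `(A, B)` is `pairVolume A B`. The sums are Minkowski sums; the
term of the empty `I` is `pairVolume {0} {0} = 0`. -/
noncomputable def mixedVolume {n : ℕ} (A B : Fin n → Set (Fin n → ℝ)) : ℝ :=
  (1 / (n ! : ℝ)) * ∑ I : Finset (Fin n),
    (-1 : ℝ) ^ (n - I.card) * pairVolume (∑ i ∈ I, A i) (∑ i ∈ I, B i)

/-- The relative mixed volume of a tuple: the mixed volume of the pairs `(C, B i)`. -/
noncomputable def relMixedVolume {n : ℕ} (B : Fin n → Set (Fin n → ℝ)) : ℝ :=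
  mixedVolume (fun _ => orthant n) B

/-- The tuple `B` is minimal by inclusion with mixed volume `V`: its relative mixed volume is `V`,
and enlarging any one `B i` to the convex hull of `B i` and a further lattice point of the orthant
makes the relative mixed volume smaller than `V`. -/
def IsMinimalTuple {n : ℕ} (B : Fin n → Set (Fin n → ℝ)) (V : ℝ) : Prop :=
  relMixedVolume B = V ∧
    ∀ i, ∀ δ ∈ orthant n \ B i, IsLatticePoint δ →
      relMixedVolume (Function.update B i (convexHull ℝ (B i ∪ {δ}))) < V

/-- The set `C_{V,…,V}`: the part of the orthant lying on or beyond the hyperplane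
`x₁ + ⋯ + xₙ = V`, which is the hyperplane through `V e₁, …, V eₙ`. -/
def cutOrthant (n : ℕ) (V : ℝ) : Set (Fin n → ℝ) := {x | x ∈ orthant n ∧ V ≤ ∑ i, x i}

end RelMixedVolume

/-!
The proof turns relative mixed volumes into mixed multiplicities of monomial ideals and uses that
these are natural numbers, monotone, and concave along a suitable family of ideals.

*Reduction to Newton polyhedra.* A closed convex set at bounded distance from the orthant `C` is
stable under adding vectors of `C`. If some `B i` is not contained in `C`, then either `n ≥ 2`, and
the difference is unbounded, or `n = 1` and `B i` contains `C`, so that nothing is to be proved.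
Otherwise Hahn-Banach and the existence of extreme points give `B i = conv (A i) + C` for a finite
set `A i ⊆ ℕⁿ` (`exists_eq_newtonPolyhedron`), and `A i` generates a monomial ideal `Iᵢ` of finite
colength.

*Hilbert functions.* Let `F k` be the colength of `∏ i, Iᵢ ^ kᵢ`, for any finite family of such
ideals. If `I^p ⊆ I^q`, then `F (k + p) - F (k + q)` is the Hilbert function of a finitely generated
multigraded module, hence, by a Stanley decomposition, for large `k` a sum of products of binomial
coefficients (`isBinomialSum_ncard_sdiff`). It grows like a polynomial of degree at most `n - 1`
(`ncard_sdiff_le`), and since all summands are nonnegative they have degree at most `n - 1`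
themselves. So its mixed differences of order `n - 1` are eventually constant natural numbers
(`mixedDiff_colength_sub_eventually_const`).

*Volumes.* The volume of `C \ ∑ i ∈ J, (conv (A i) + C)` is the limit of `F (K + t • 1_J) / t ^ n`
(`tendsto_colength_div_pow`), where the base point `K` may be chosen so large that the eventual
formulas apply. Hence the relative mixed volume is the eventual value of the mixed difference of
`F` in `n` directions (`relMixedVolume_newtonPolyhedron`). Comparing several ideals in one place of
the tuple inside a single function `F` gives integrality, monotonicity and concavity at once
(`exists_relMixedVolume_eq`).

*Conclusion.* Let `V` be the relative mixed volume, `𝔪` the maximal ideal, and `c k` the relative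
mixed volume after replacing `Iᵢ` by `Iᵢ + 𝔪 ^ k`. Since
`(Iᵢ + 𝔪 ^ (k + 1)) ^ 2 ⊆ (Iᵢ + 𝔪 ^ k) * (Iᵢ + 𝔪 ^ (k + 2))`, the sequence `c` is concave. It is also
nondecreasing, takes values in `ℕ`, and is eventually equal to `V`. Such a sequence grows by at
least one in each step until it reaches `V`, so `c V = V` (`apply_limit_eq_of_concave`). By
monotonicity, adding to `B i` a single lattice point with coordinate sum at least `V` does not
lower the relative mixed volume, so minimality puts all these points into `B i`, and in particular
the points `V eⱼ`. Finally `C_{V,…,V} = conv {V e₁, …, V eₙ} + C`.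
-/

namespace RelMixedVolume

/-! ### Stanley decompositions of down-sets of `ℕᴺ` -/

/-- Finite disjoint unions of cones `β + ℕ^S ⊆ ℕᴺ`, where `ℕ^S` consists of the vectors supported
on the set `S` of coordinates. -/
inductive StanleyDecomposable {N : ℕ} : Set (Fin N → ℕ) → Prop
  | empty : StanleyDecomposable ∅
  | cone (β : Fin N → ℕ) (S : Finset (Fin N)) :
      StanleyDecomposable {α | β ≤ α ∧ ∀ j ∉ S, α j = β j}
  | union {D E : Set (Fin N → ℕ)} : Disjoint D E → StanleyDecomposable D →
      StanleyDecomposable E → StanleyDecomposable (D ∪ E)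

theorem StanleyDecomposable.cons_eq {N : ℕ} {E : Set (Fin N → ℕ)} (hE : StanleyDecomposable E)
    (r : ℕ) : StanleyDecomposable {α : Fin (N + 1) → ℕ | α 0 = r ∧ Fin.tail α ∈ E} := by
  induction hE with
  | empty => simpa using StanleyDecomposable.empty
  | cone β S =>
    convert StanleyDecomposable.cone (Fin.cons r β : Fin (N + 1) → ℕ)
      (S.map (Fin.succEmb N)) using 1
    ext α
    simp only [Set.mem_ofPred_eq, Pi.le_def, Fin.forall_fin_succ, Fin.tail, Fin.cons_zero,
      Fin.cons_succ, Finset.mem_map, Fin.coe_succEmb]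
    simp only [Fin.succ_ne_zero, and_false, exists_false, not_false_eq_true, Fin.succ_inj,
      exists_eq_right, forall_const]
    constructor
    · rintro ⟨h0, h1, h2⟩
      exact ⟨⟨h0.ge, h1⟩, h0, h2⟩
    · rintro ⟨⟨-, h1⟩, h0, h2⟩
      exact ⟨h0, h1, h2⟩
  | union hd _ _ h1 h2 =>
    convert StanleyDecomposable.union ?_ h1 h2 using 1
    · ext α
      simp only [Set.mem_ofPred_eq, Set.mem_union]
      tauto
    · rw [Set.disjoint_left] at hd ⊢
      exact fun α h h' => hd h.2 h'.2

theorem StanleyDecomposable.cons_ge {N : ℕ} {E : Set (Fin N → ℕ)} (hE : StanleyDecomposable E)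
    (r : ℕ) : StanleyDecomposable {α : Fin (N + 1) → ℕ | r ≤ α 0 ∧ Fin.tail α ∈ E} := by
  induction hE with
  | empty => simpa using StanleyDecomposable.empty
  | cone β S =>
    convert StanleyDecomposable.cone (Fin.cons r β : Fin (N + 1) → ℕ)
      (insert 0 (S.map (Fin.succEmb N))) using 1
    ext α
    simp only [Set.mem_ofPred_eq, Pi.le_def, Fin.forall_fin_succ, Fin.tail, Fin.cons_zero,
      Fin.cons_succ, Finset.mem_insert, Finset.mem_map, Fin.coe_succEmb]
    simp only [Fin.succ_ne_zero, Fin.succ_inj, exists_eq_right, false_or, true_or, not_true,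
      false_imp_iff, true_and, and_assoc]
  | union hd _ _ h1 h2 =>
    convert StanleyDecomposable.union ?_ h1 h2 using 1
    · ext α
      simp only [Set.mem_ofPred_eq, Set.mem_union]
      tauto
    · rw [Set.disjoint_left] at hd ⊢
      exact fun α h h' => hd h.2 h'.2

/-- Dickson's lemma, in the form of the descending chain condition for down-sets. -/
theorem exists_stable_of_antitone_isLowerSet {N : ℕ} (D : ℕ → Set (Fin N → ℕ))
    (hD : ∀ r, IsLowerSet (D r)) (hanti : Antitone D) : ∃ r₀, ∀ r ≥ r₀, D r = D r₀ := by
  by_contra! h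
  have h' : ∀ r₀, ∃ r, r₀ ≤ r ∧ ∃ x, x ∈ D r₀ ∧ x ∉ D r := by
    intro r₀
    obtain ⟨r, hr, hne⟩ := h r₀
    refine ⟨r, hr, ?_⟩
    by_contra! h2
    exact hne (Set.Subset.antisymm (hanti hr) h2)
  choose r hr x hx hx' using h'
  let g : ℕ → ℕ := fun k => r^[k] 0
  have hg : ∀ k, g (k + 1) = r (g k) := fun k => Function.iterate_succ_apply' r k 0
  have hmono : Monotone g := monotone_nat_of_le_succ fun k => by rw [hg]; exact hr _
  obtain ⟨k, l, hkl, hle⟩ := wellQuasiOrdered_le (fun k => x (g k))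
  refine hx' (g k) ?_
  rw [← hg]
  exact hD _ hle (hanti (hmono hkl) (hx (g l)))

/-- Every down-set of `ℕᴺ` has a Stanley decomposition: slice it by the values of one coordinate;
the slices decrease and eventually stabilize. -/
theorem stanleyDecomposable_of_isLowerSet {N : ℕ} {D : Set (Fin N → ℕ)} (hD : IsLowerSet D) :
    StanleyDecomposable D := by
  induction N with
  | zero =>
    rcases D.eq_empty_or_nonempty with rfl | ⟨x, hx⟩
    · exact .empty
    · convert StanleyDecomposable.cone (0 : Fin 0 → ℕ) ∅ using 1
      ext α
      simp only [Subsingleton.elim α x, hx, true_iff]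
      exact ⟨fun j => j.elim0, fun j => j.elim0⟩
  | succ N ih =>
    let s : ℕ → Set (Fin N → ℕ) := fun r => {β | (Fin.cons r β : Fin (N + 1) → ℕ) ∈ D}
    have hs : ∀ r, IsLowerSet (s r) := fun r β β' hle hβ => hD (by
      intro j
      refine Fin.cases ?_ (fun j => ?_) j
      · simp
      · simpa using hle j) hβ
    have hanti : Antitone s := fun r r' hrr β hβ => hD (by
      intro j
      refine Fin.cases ?_ (fun j => ?_) j
      · simpa using hrr
      · simp) hβ
    obtain ⟨r₀, hr₀⟩ := exists_stable_of_antitone_isLowerSet s hs hanti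
    have mem : ∀ α, α ∈ D ↔ Fin.tail α ∈ s (α 0) := fun α => by
      simp only [s, Set.mem_ofPred_eq, Fin.cons_self_tail]
    have low : ∀ r, StanleyDecomposable {α | α ∈ D ∧ α 0 < r} := by
      intro r
      induction r with
      | zero => simpa using StanleyDecomposable.empty
      | succ r ihr =>
        convert ihr.union ?_ ((ih (hs r)).cons_eq r) using 1
        · ext α
          simp only [Set.mem_ofPred_eq, Set.mem_union, mem]
          constructor
          · rintro ⟨h1, h2⟩
            rcases Nat.lt_succ_iff_lt_or_eq.1 h2 with h | h
            · exact .inl ⟨h1, h⟩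
            · exact .inr ⟨h, h ▸ h1⟩
          · rintro (⟨h1, h2⟩ | ⟨rfl, h2⟩)
            · exact ⟨h1, h2.trans (Nat.lt_succ_self r)⟩
            · exact ⟨h2, Nat.lt_succ_self _⟩
        · rw [Set.disjoint_left]
          rintro α ⟨-, h1⟩ ⟨h2, -⟩
          omega
    convert (low r₀).union ?_ ((ih (hs r₀)).cons_ge r₀) using 1
    · ext α
      simp only [Set.mem_ofPred_eq, Set.mem_union, mem]
      rcases lt_or_ge (α 0) r₀ with h | h
      · simp [h, h.not_ge]
      · simp [h, h.not_gt, hr₀ _ h]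
    · rw [Set.disjoint_left]
      rintro α ⟨-, h1⟩ ⟨h2, -⟩
      omega

/-! ### Counting by multidegree -/

/-- The multidegree of an exponent vector `α` for a colouring `c` of the coordinates: its entry
of index `i` is the sum of the entries of `α` of colour `i`. -/
def colorDeg {N : ℕ} {ι : Type*} [DecidableEq ι] (c : Fin N → ι) (α : Fin N → ℕ) : ι → ℕ :=
  fun i => ∑ j with c j = i, α j

theorem colorDeg_add {N : ℕ} {ι : Type*} [DecidableEq ι] (c : Fin N → ι) (α β : Fin N → ℕ) :
    colorDeg c (α + β) = colorDeg c α + colorDeg c β := by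
  ext i
  simp [colorDeg, Finset.sum_add_distrib]

theorem le_colorDeg {N : ℕ} {ι : Type*} [DecidableEq ι] (c : Fin N → ι) (α : Fin N → ℕ)
    (j : Fin N) : α j ≤ colorDeg c α (c j) :=
  Finset.single_le_sum (f := α) (fun _ _ => Nat.zero_le _) (by simp)

theorem finite_colorDeg_eq {N : ℕ} {ι : Type*} [DecidableEq ι] (c : Fin N → ι) (k : ι → ℕ) :
    {α : Fin N → ℕ | colorDeg c α = k}.Finite := by
  refine (Set.finite_Iic (fun j => k (c j))).subset ?_
  rintro α rfl j
  exact le_colorDeg c α j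

/-- The number of elements of multidegree `k` of a set `D` of exponent vectors. -/
noncomputable def levelCount {N : ℕ} {ι : Type*} [DecidableEq ι] (c : Fin N → ι)
    (D : Set (Fin N → ℕ)) (k : ι → ℕ) : ℕ :=
  {α | α ∈ D ∧ colorDeg c α = k}.ncard

/-- Functions on `ℕ^ι` which on some translate of the orthant are finite sums of products
`∏ i, (kᵢ + aᵢ choose eᵢ)`. -/
def IsBinomialSum {ι : Type*} [Fintype ι] (f : (ι → ℕ) → ℕ) : Prop :=
  ∃ (K : ι → ℕ) (L : List ((ι → ℕ) × (ι → ℕ))),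
    ∀ k, f (K + k) = (L.map fun p => ∏ i, (k i + p.1 i).choose (p.2 i)).sum

theorem IsBinomialSum.zero {ι : Type*} [Fintype ι] : IsBinomialSum (fun _ : ι → ℕ => 0) :=
  ⟨0, [], by simp⟩

theorem IsBinomialSum.add {ι : Type*} [Fintype ι] {f g : (ι → ℕ) → ℕ} (hf : IsBinomialSum f)
    (hg : IsBinomialSum g) : IsBinomialSum (fun k => f k + g k) := by
  obtain ⟨K, L, h⟩ := hf
  obtain ⟨K', L', h'⟩ := hg
  refine ⟨K + K', L.map (fun p => (K' + p.1, p.2)) ++ L'.map (fun p => (K + p.1, p.2)), ?_⟩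
  intro k
  have e1 := h (K' + k)
  have e2 := h' (K + k)
  rw [← add_assoc] at e1 e2
  rw [add_comm K' K] at e2
  show f _ + g _ = _
  rw [e1, e2]
  simp only [List.map_append, List.sum_append, List.map_map, Function.comp_def, Pi.add_apply]
  congr 3 <;> (ext p; refine Finset.prod_congr rfl fun i _ => ?_; congr 1; ring)

theorem IsBinomialSum.sum {ι κ : Type*} [Fintype ι] (s : Finset κ) {f : κ → (ι → ℕ) → ℕ}
    (hf : ∀ u ∈ s, IsBinomialSum (f u)) : IsBinomialSum (fun k => ∑ u ∈ s, f u k) := by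
  classical
  induction s using Finset.induction_on with
  | empty => simpa using IsBinomialSum.zero
  | insert a s ha ih =>
    simp only [Finset.sum_insert ha]
    exact (hf a (by simp)).add (ih fun u hu => hf u (by simp [hu]))

/-- The number of vectors of multidegree `m` supported on `S`: stars and bars, in each colour. -/
theorem ncard_support_colorDeg {N : ℕ} {ι : Type*} [Fintype ι] [DecidableEq ι] (c : Fin N → ι)
    (S : Finset (Fin N)) (m : ι → ℕ) :
    {γ : Fin N → ℕ | (∀ j ∉ S, γ j = 0) ∧ colorDeg c γ = m}.ncard =
      ∏ i, (S.filter fun j => c j = i).card.multichoose (m i) := by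
  classical
  have key : Set.BijOn
      (fun (γ : Fin N → ℕ) (i : ι) =>
        Finsupp.equivFunOnFinite.symm (fun j => if c j = i then γ j else 0))
      {γ : Fin N → ℕ | (∀ j ∉ S, γ j = 0) ∧ colorDeg c γ = m}
      (Fintype.piFinset fun i => (S.filter fun j => c j = i).finsuppAntidiag (m i) :
        Finset (ι → Fin N →₀ ℕ)) := by
    refine ⟨?_, ?_, ?_⟩
    · rintro γ ⟨h1, rfl⟩
      simp only [Finset.mem_coe, Fintype.mem_piFinset, Finset.mem_finsuppAntidiag]
      intro i
      constructor
      · simp only [Finsupp.equivFunOnFinite_symm_apply_apply, colorDeg, Finset.sum_filter]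
        rw [← Finset.sum_subset (Finset.subset_univ S)]
        · exact Finset.sum_congr rfl fun j _ => by split_ifs <;> rfl
        · intro j _ hj
          simp [h1 j hj]
      · intro j hj
        simp only [Finsupp.mem_support_iff, Finsupp.equivFunOnFinite_symm_apply_apply, ne_eq,
          ite_eq_right_iff, Classical.not_imp] at hj
        simp only [Finset.mem_filter]
        refine ⟨?_, hj.1⟩
        by_contra hjS
        exact hj.2 (h1 j hjS)
    · intro γ _ γ' _ h
      ext j
      have := DFunLike.congr_fun (congrFun h (c j)) j
      simpa using this
    · intro q hq
      simp only [Finset.mem_coe, Fintype.mem_piFinset, Finset.mem_finsuppAntidiag] at hq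
      have hsupp : ∀ i j, ¬ (j ∈ S ∧ c j = i) → q i j = 0 := by
        intro i j hj
        by_contra hne
        exact hj (by simpa using (hq i).2 (Finsupp.mem_support_iff.2 hne))
      refine ⟨fun j => q (c j) j, ⟨fun j hj => hsupp _ _ fun h => hj h.1, ?_⟩, ?_⟩
      · ext i
        rw [← (hq i).1, colorDeg, Finset.sum_filter, Finset.sum_filter,
          ← Finset.sum_subset (Finset.subset_univ S)]
        · exact Finset.sum_congr rfl fun j _ => by split_ifs with h <;> simp [h]
        · intro j _ hj
          split_ifs
          · exact hsupp _ _ fun h => hj h.1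
          · rfl
      · ext i j
        simp only [Finsupp.equivFunOnFinite_symm_apply_apply]
        split_ifs with h
        · rw [h]
        · exact (hsupp _ _ fun h' => h h'.2).symm
  rw [← key.injOn.ncard_image, key.image_eq, Set.ncard_coe_finset,
    Fintype.card_piFinset]
  simp [Finset.card_finsuppAntidiag_nat_eq_multichoose]

theorem isBinomialSum_levelCount_cone {N : ℕ} {ι : Type*} [Fintype ι] [DecidableEq ι]
    (c : Fin N → ι) (β : Fin N → ℕ) (S : Finset (Fin N)) :
    IsBinomialSum (levelCount c {α | β ≤ α ∧ ∀ j ∉ S, α j = β j}) := by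
  have key : ∀ k, levelCount c {α | β ≤ α ∧ ∀ j ∉ S, α j = β j} (colorDeg c β + k) =
      ∏ i, (S.filter fun j => c j = i).card.multichoose (k i) := by
    intro k
    rw [← ncard_support_colorDeg, levelCount]
    refine Eq.trans (congrArg Set.ncard ?_)
      (Set.ncard_image_of_injective _ (add_right_injective β))
    ext α
    simp only [Set.mem_ofPred_eq, Set.mem_image]
    constructor
    · rintro ⟨⟨h1, h2⟩, h3⟩
      obtain ⟨γ, rfl⟩ := exists_add_of_le h1
      refine ⟨γ, ⟨fun j hj => by simpa using h2 j hj, ?_⟩, rfl⟩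
      rw [colorDeg_add] at h3
      exact add_left_cancel h3
    · rintro ⟨γ, ⟨h1, rfl⟩, rfl⟩
      exact ⟨⟨le_self_add, fun j hj => by simp [h1 j hj]⟩, colorDeg_add _ _ _⟩
  by_cases hS : ∀ i, (S.filter fun j => c j = i).Nonempty
  · refine ⟨colorDeg c β, [(fun i => (S.filter fun j => c j = i).card - 1,
      fun i => (S.filter fun j => c j = i).card - 1)], fun k => ?_⟩
    rw [key]
    simp only [List.map_cons, List.map_nil, List.sum_cons, List.sum_nil, add_zero]
    refine Finset.prod_congr rfl fun i _ => ?_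
    have hpos := Finset.card_pos.2 (hS i)
    rw [Nat.multichoose_eq, ← Nat.choose_symm_of_eq_add]
    · congr 1
      omega
    · omega
  · push Not at hS
    obtain ⟨i, hi⟩ := hS
    refine ⟨colorDeg c β + 1, [], fun k => ?_⟩
    rw [add_assoc, key]
    simp only [List.map_nil, List.sum_nil]
    refine Finset.prod_eq_zero (Finset.mem_univ i) ?_
    rw [hi, Finset.card_empty, Pi.add_apply, Pi.one_apply, add_comm, Nat.multichoose_zero_succ]

theorem StanleyDecomposable.isBinomialSum_levelCount {N : ℕ} {ι : Type*} [Fintype ι]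
    [DecidableEq ι] (c : Fin N → ι) {D : Set (Fin N → ℕ)} (hD : StanleyDecomposable D) :
    IsBinomialSum (levelCount c D) := by
  induction hD with
  | empty =>
    convert IsBinomialSum.zero (ι := ι) using 2
    simp [levelCount]
  | cone β S => exact isBinomialSum_levelCount_cone c β S
  | union hd _ _ h1 h2 =>
    convert h1.add h2 using 2 with k
    rw [levelCount, levelCount, levelCount, ← Set.ncard_union_eq ?_
      ((finite_colorDeg_eq c k).subset fun α h => h.2)
      ((finite_colorDeg_eq c k).subset fun α h => h.2)]
    · congr 1
      ext α
      simp only [Set.mem_ofPred_eq, Set.mem_union]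
      tauto
    · rw [Set.disjoint_left] at hd ⊢
      exact fun α h h' => hd h.1 h'.1

/-! ### Products of monomial ideals and their Hilbert functions -/

/-- The exponent of the product of the monomials with exponents `a j`, taken `α j` times each. -/
def weight {N n : ℕ} (a : Fin N → Fin n → ℕ) (α : Fin N → ℕ) : Fin n → ℕ := ∑ j, α j • a j

theorem weight_add {N n : ℕ} (a : Fin N → Fin n → ℕ) (α β : Fin N → ℕ) :
    weight a (α + β) = weight a α + weight a β := by
  simp [weight, add_smul, Finset.sum_add_distrib]

/-- The exponents of the monomials in the ideal `∏ i, Iᵢ ^ kᵢ`, where the monomial ideal `Iᵢ` is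
generated by the monomials with exponents `a j` for the indices `j` of colour `c j = i`. -/
def powerIdeal {N n : ℕ} {ι : Type*} [DecidableEq ι] (a : Fin N → Fin n → ℕ) (c : Fin N → ι)
    (k : ι → ℕ) : Set (Fin n → ℕ) :=
  {x | ∃ α, colorDeg c α = k ∧ weight a α ≤ x}

theorem single_le_of_le_apply {κ : Type*} [DecidableEq κ] {x : κ → ℕ} {j : κ} {r : ℕ}
    (h : r ≤ x j) : Pi.single j r ≤ x := by
  intro i
  by_cases hi : i = j
  · subst hi
    simpa using h
  · simp [hi]

section powerIdeal

variable {N n : ℕ} {ι : Type*} [DecidableEq ι] {a : Fin N → Fin n → ℕ} {c : Fin N → ι}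

theorem isUpperSet_powerIdeal (k : ι → ℕ) : IsUpperSet (powerIdeal a c k) := by
  rintro x y hxy ⟨α, h1, h2⟩
  exact ⟨α, h1, h2.trans hxy⟩

theorem weight_mem_powerIdeal (α : Fin N → ℕ) : weight a α ∈ powerIdeal a c (colorDeg c α) :=
  ⟨α, rfl, le_rfl⟩

theorem add_mem_powerIdeal {x y : Fin n → ℕ} {k l : ι → ℕ} (hx : x ∈ powerIdeal a c k)
    (hy : y ∈ powerIdeal a c l) : x + y ∈ powerIdeal a c (k + l) := by
  obtain ⟨α, rfl, h⟩ := hx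
  obtain ⟨β, rfl, h'⟩ := hy
  exact ⟨α + β, colorDeg_add c α β, by rw [weight_add]; exact add_le_add h h'⟩

/-- Every multidegree below that of `γ` is the multidegree of a vector below `γ`. -/
theorem exists_le_colorDeg_eq (γ : Fin N → ℕ) (k : ι → ℕ) (h : k ≤ colorDeg c γ) :
    ∃ α ≤ γ, colorDeg c α = k := by
  induction hs : ∑ j, γ j generalizing γ with
  | zero =>
    refine ⟨γ, le_rfl, le_antisymm ?_ h⟩
    intro i
    have : ∀ j, γ j = 0 := fun j => by
      simpa using Finset.sum_eq_zero_iff.1 hs j (Finset.mem_univ j)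
    simp [colorDeg, this]
  | succ s ih =>
    by_cases heq : k = colorDeg c γ
    · exact ⟨γ, le_rfl, heq.symm⟩
    obtain ⟨i, hi⟩ : ∃ i, k i < colorDeg c γ i := by
      by_contra! h'
      exact heq (le_antisymm h h')
    obtain ⟨j, hj, hne⟩ : ∃ j ∈ Finset.univ.filter (fun j => c j = i), γ j ≠ 0 :=
      Finset.exists_ne_zero_of_sum_ne_zero (show colorDeg c γ i ≠ 0 by omega)
    obtain ⟨γ', hγ'⟩ : ∃ γ' : Fin N → ℕ, γ = γ' + Pi.single j 1 := by
      have hle : Pi.single j 1 ≤ γ := single_le_of_le_apply (Nat.one_le_iff_ne_zero.2 hne)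
      exact ⟨γ - Pi.single j 1, (tsub_add_cancel_of_le hle).symm⟩
    have hji : c j = i := by simpa using hj
    have hdeg : colorDeg c (Pi.single j 1) = Pi.single i 1 := by
      ext i'
      rw [colorDeg, Finset.sum_filter, Finset.sum_eq_single j]
      · by_cases h' : i' = i
        · subst h'; simp [hji]
        · simp [h', hji, Ne.symm h']
      · intro j' _ hj'
        simp [hj']
      · simp
    subst hγ'
    rw [colorDeg_add, hdeg] at h hi
    obtain ⟨α, hα, hk⟩ := ih γ' (by
      intro i'
      have := h i'
      by_cases h' : i' = i
      · subst h'
        simp only [Pi.add_apply, Pi.single_eq_same] at hi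
        exact Nat.lt_succ_iff.1 hi
      · simpa [h'] using this) (by
      simp only [Pi.add_apply, Finset.sum_add_distrib, Finset.sum_pi_single', Finset.mem_univ,
        if_true] at hs
      omega)
    exact ⟨α, hα.trans le_self_add, hk⟩

theorem mem_powerIdeal_add_iff {x : Fin n → ℕ} {k q : ι → ℕ} :
    x ∈ powerIdeal a c (k + q) ↔
      ∃ u ∈ powerIdeal a c q, ∃ α, colorDeg c α = k ∧ u + weight a α = x := by
  constructor
  · rintro ⟨γ, h1, h2⟩
    obtain ⟨α, hα, hk⟩ := exists_le_colorDeg_eq (c := c) γ k (by rw [h1]; exact le_self_add)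
    obtain ⟨β, rfl⟩ := exists_add_of_le hα
    obtain ⟨y, rfl⟩ := exists_add_of_le h2
    rw [colorDeg_add, hk] at h1
    refine ⟨weight a β + y, ⟨β, add_left_cancel h1, le_self_add⟩, α, hk, ?_⟩
    rw [weight_add]
    abel
  · rintro ⟨u, hu, α, rfl, rfl⟩
    rw [add_comm (colorDeg c α)]
    exact add_mem_powerIdeal hu (weight_mem_powerIdeal α)

/-- Each of the ideals contains a monomial dividing `x_j ^ R`, for every variable `x_j`. In
particular all the ideals have finite colength. -/
def HasAxisGenerators {N n : ℕ} {ι : Type*} (a : Fin N → Fin n → ℕ) (c : Fin N → ι)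
    (R : ℕ) : Prop :=
  ∀ i j, ∃ l, c l = i ∧ a l ≤ Pi.single j R

theorem HasAxisGenerators.mem_powerIdeal [Fintype ι] {R : ℕ} (hR : HasAxisGenerators a c R)
    {x : Fin n → ℕ} {k : ι → ℕ} (j : Fin n) (hx : R * ∑ i, k i ≤ x j) :
    x ∈ powerIdeal a c k := by
  choose l hl1 hl2 using fun i => hR i j
  refine ⟨∑ i, Pi.single (l i) (k i), ?_, ?_⟩
  · ext i
    simp only [colorDeg, Finset.sum_apply]
    rw [Finset.sum_comm, Finset.sum_eq_single i]
    · rw [Finset.sum_eq_single (l i)]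
      · simp
      · intro j' _ hj'
        simp [hj']
      · simp [hl1]
    · intro i' _ hi'
      refine Finset.sum_eq_zero fun j' hj' => ?_
      rw [Pi.single_eq_of_ne]
      rintro rfl
      simp only [Finset.mem_filter, hl1] at hj'
      exact hi' hj'.2
    · simp
  · have hw : weight a (∑ i, Pi.single (l i) (k i)) = ∑ i, k i • a (l i) := by
      simp only [weight, Finset.sum_apply, Finset.sum_smul]
      rw [Finset.sum_comm]
      refine Finset.sum_congr rfl fun i _ => ?_
      rw [Finset.sum_eq_single (l i)]
      · simp
      · intro j' _ hj'
        simp [hj']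
      · simp
    rw [hw]
    calc ∑ i, k i • a (l i) ≤ ∑ i, k i • Pi.single j R :=
          Finset.sum_le_sum fun i _ => nsmul_le_nsmul_right (hl2 i) _
      _ = Pi.single j (R * ∑ i, k i) := by
          rw [← Finset.sum_smul, ← Pi.single_smul, smul_eq_mul, mul_comm]
      _ ≤ x := single_le_of_le_apply hx

theorem HasAxisGenerators.lt_of_notMem [Fintype ι] {R : ℕ} (hR : HasAxisGenerators a c R)
    {x : Fin n → ℕ} {k : ι → ℕ} (hx : x ∉ powerIdeal a c k) (j : Fin n) :
    x j < R * ∑ i, k i := by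
  by_contra! h
  exact hx (hR.mem_powerIdeal j h)

theorem HasAxisGenerators.finite_compl [Fintype ι] {R : ℕ} (hR : HasAxisGenerators a c R)
    (k : ι → ℕ) : (powerIdeal a c k)ᶜ.Finite :=
  (Set.finite_Iic (fun _ : Fin n => R * ∑ i, k i)).subset fun _ hx j => (hR.lt_of_notMem hx j).le

/-- The Hilbert function of the multigraded module `⨁ₖ Iᵏ⁺ᑫ / Iᵏ⁺ᵖ` is eventually a sum of products
of binomial coefficients. This module is generated over the polynomial ring in the generators
`a j` by the finitely many monomials in `I^q \ I^p`. Each monomial of the module has a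
lexicographically least expression `u + weight a α` with `u` such a generator, and for fixed `u`
the vectors `α` occurring in this way form a down-set. -/
theorem isBinomialSum_ncard_sdiff [Fintype ι] {R : ℕ} (hR : HasAxisGenerators a c R)
    (p q : ι → ℕ) :
    IsBinomialSum fun k => (powerIdeal a c (k + q) \ powerIdeal a c (k + p)).ncard := by
  classical
  have hfin : (powerIdeal a c q \ powerIdeal a c p).Finite :=
    (hR.finite_compl p).subset fun x hx => hx.2
  let key : (Fin n → ℕ) → (Fin N → ℕ) → Lex (Fin n → ℕ) ×ₗ Lex (Fin N → ℕ) :=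
    fun u α => toLex (toLex u, toLex α)
  let U := hfin.toFinset
  let D : (Fin n → ℕ) → Set (Fin N → ℕ) := fun u =>
    {α | u + weight a α ∉ powerIdeal a c (colorDeg c α + p) ∧ ∀ u' ∈ U, ∀ α',
      colorDeg c α' = colorDeg c α → u' + weight a α' = u + weight a α → key u α ≤ key u' α'}
  have hlower : ∀ u, IsLowerSet (D u) := by
    rintro u γ α hle ⟨h1, h2⟩
    obtain ⟨β, rfl⟩ := exists_add_of_le hle
    refine ⟨fun h => h1 ?_, fun u' hu' α' hdeg hw => ?_⟩
    · convert add_mem_powerIdeal h (weight_mem_powerIdeal (a := a) (c := c) β) using 1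
      · rw [colorDeg_add, add_right_comm]
      · rw [weight_add, add_assoc]
    · have := h2 u' hu' (α' + β) (by rw [colorDeg_add, colorDeg_add, hdeg])
        (by rw [weight_add, weight_add, ← add_assoc, hw, add_assoc])
      rw [Prod.Lex.le_iff] at this ⊢
      refine this.imp id fun h => ⟨h.1, ?_⟩
      have h3 : toLex α + toLex β ≤ toLex α' + toLex β := h.2
      exact le_of_add_le_add_right h3
  have hcount : ∀ k, (powerIdeal a c (k + q) \ powerIdeal a c (k + p)).ncard =
      ∑ u ∈ U, levelCount c (D u) k := by
    intro k
    have hlev : ∀ u, {α | α ∈ D u ∧ colorDeg c α = k}.Finite := fun u =>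
      (finite_colorDeg_eq c k).subset fun α h => h.2
    have hbij : Set.BijOn (fun z : (_ : Fin n → ℕ) × (Fin N → ℕ) => z.1 + weight a z.2)
        (U.sigma fun u => (hlev u).toFinset :
          Finset ((_ : Fin n → ℕ) × (Fin N → ℕ)))
        (powerIdeal a c (k + q) \ powerIdeal a c (k + p)) := by
      refine ⟨?_, ?_, ?_⟩
      · rintro ⟨u, α⟩ h
        simp only [Finset.coe_sigma, Set.mem_sigma_iff, Finset.mem_coe, Set.Finite.mem_toFinset,
          Set.mem_ofPred_eq, U, D] at h
        obtain ⟨⟨hu, -⟩, ⟨hα, -⟩, rfl⟩ := h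
        exact ⟨mem_powerIdeal_add_iff.2 ⟨u, hu, α, rfl, rfl⟩, hα⟩
      · rintro ⟨u, α⟩ h ⟨u', α'⟩ h' heq
        simp only [Finset.coe_sigma, Set.mem_sigma_iff, Finset.mem_coe, Set.Finite.mem_toFinset,
          Set.mem_ofPred_eq] at h h'
        obtain ⟨hu, ⟨-, hα⟩, rfl⟩ := h
        obtain ⟨hu', ⟨-, hα'⟩, hdeg⟩ := h'
        have e : key u α = key u' α' :=
          le_antisymm (hα u' hu' α' hdeg heq.symm) (hα' u hu α hdeg.symm heq)
        have e' : (toLex u, toLex α) = (toLex u', toLex α') := toLex.injective e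
        rw [Prod.mk.injEq] at e'
        rw [toLex.injective e'.1, toLex.injective e'.2]
      · intro x hx
        let S : Set (Lex (Fin n → ℕ) ×ₗ Lex (Fin N → ℕ)) :=
          {z | ∃ u ∈ U, ∃ α, colorDeg c α = k ∧ u + weight a α = x ∧ key u α = z}
        have hS : S.Nonempty := by
          obtain ⟨u, hu, α, hα, rfl⟩ := mem_powerIdeal_add_iff.1 hx.1
          refine ⟨key u α, u, ?_, α, hα, rfl, rfl⟩
          rw [Set.Finite.mem_toFinset]
          exact ⟨hu, fun h => hx.2 (mem_powerIdeal_add_iff.2 ⟨u, h, α, hα, rfl⟩)⟩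
        obtain ⟨u, hu, α, rfl, rfl, hz⟩ := WellFounded.min_mem wellFounded_lt S hS
        refine ⟨⟨u, α⟩, ?_, rfl⟩
        simp only [Finset.coe_sigma, Set.mem_sigma_iff, Finset.mem_coe, Set.Finite.mem_toFinset,
          Set.mem_ofPred_eq]
        refine ⟨hu, ⟨hx.2, fun u' hu' α' hdeg hw => ?_⟩, trivial⟩
        rw [hz]
        exact not_lt.1 (WellFounded.not_lt_min wellFounded_lt S ⟨u', hu', α', hdeg, hw, rfl⟩)
    rw [← hbij.image_eq, hbij.injOn.ncard_image, Set.ncard_coe_finset, Finset.card_sigma]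
    refine Finset.sum_congr rfl fun u _ => ?_
    rw [levelCount, Set.ncard_eq_toFinset_card _ (hlev u)]
  simp only [hcount]
  exact IsBinomialSum.sum U fun u _ =>
    (stanleyDecomposable_of_isLowerSet (hlower u)).isBinomialSum_levelCount c

/-- The module `⨁ₖ Iᵏ⁺ᑫ / Iᵏ⁺ᵖ` lives in a thin layer along the boundary of `Iᵏ`: every line in a
coordinate direction meets it in boundedly many points, so that its Hilbert function has growth
of order at most `n - 1`. -/
theorem ncard_sdiff_le [Fintype ι] {R : ℕ} (hR : HasAxisGenerators a c R) (j₀ : Fin n)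
    (p q : ι → ℕ) : ∃ C : ℕ, ∀ k : ι → ℕ,
      (powerIdeal a c (k + q) \ powerIdeal a c (k + p)).ncard ≤ C * (∑ i, k i + 1) ^ (n - 1) := by
  classical
  refine ⟨(R * ∑ i, p i) * (R * (∑ i, p i + 1)) ^ (n - 1), fun k => ?_⟩
  have hfin : (powerIdeal a c (k + q) \ powerIdeal a c (k + p)).Finite :=
    (hR.finite_compl (k + p)).subset fun x hx => hx.2
  set L := R * ∑ i, (k + p) i with hL
  rw [Set.ncard_eq_toFinset_card _ hfin]
  let f : (Fin n → ℕ) → (Fin n → ℕ) := fun x => Function.update x j₀ 0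
  have hfib : ∀ b ∈ hfin.toFinset.image f, (hfin.toFinset.filter fun x => f x = b).card ≤
      R * ∑ i, p i := by
    intro b hb
    obtain ⟨x₁, hx₁, rfl⟩ := Finset.mem_image.1 hb
    obtain ⟨x₀, hx₀, hmin⟩ := Finset.exists_min_image
      (hfin.toFinset.filter fun x => f x = f x₁) (fun x => x j₀) ⟨x₁, by simp [hx₁]⟩
    have hother : ∀ x ∈ hfin.toFinset.filter (fun x => f x = f x₁), ∀ j ≠ j₀, x j = x₀ j := by
      intro x hx j hj
      have e := congrFun ((Finset.mem_filter.1 hx).2.trans (Finset.mem_filter.1 hx₀).2.symm) j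
      simpa [f, hj] using e
    have hsub : Set.MapsTo (fun x : Fin n → ℕ => x j₀)
        (hfin.toFinset.filter fun x => f x = f x₁)
        (Finset.Ico (x₀ j₀) (x₀ j₀ + R * ∑ i, p i)) := by
      intro x hx
      rw [Finset.coe_Ico, Set.mem_Ico]
      refine ⟨hmin x hx, ?_⟩
      by_contra! hge
      have hx' := (Set.Finite.mem_toFinset _).1 (Finset.mem_filter.1 hx).1
      have hx₀' := (Set.Finite.mem_toFinset _).1 (Finset.mem_filter.1 hx₀).1
      obtain ⟨u, -, α, rfl, hu⟩ := mem_powerIdeal_add_iff.1 hx₀'.1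
      have h1 : x₀ ∈ powerIdeal a c (colorDeg c α) :=
        isUpperSet_powerIdeal _ (by rw [← hu]; exact le_add_self) (weight_mem_powerIdeal α)
      have h2 : Pi.single j₀ (R * ∑ i, p i) ∈ powerIdeal a c p :=
        hR.mem_powerIdeal j₀ (by simp)
      refine hx'.2 (isUpperSet_powerIdeal _ ?_ (add_mem_powerIdeal h1 h2))
      intro j
      by_cases hj : j = j₀
      · subst hj
        simpa using hge
      · simp [hj, hother x hx j hj]
    refine (Finset.card_le_card_of_injOn _ hsub ?_).trans_eq (by simp)
    intro x hx y hy hxy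
    ext j
    by_cases hj : j = j₀
    · rw [hj]; exact hxy
    · rw [hother x hx j hj, hother y hy j hj]
  have himg : (hfin.toFinset.image f).card ≤ L ^ (n - 1) := by
    have hsub : hfin.toFinset.image f ⊆
        Fintype.piFinset (fun j => if j = j₀ then {0} else Finset.range L) := by
      intro b hb
      obtain ⟨x, hx, rfl⟩ := Finset.mem_image.1 hb
      rw [Set.Finite.mem_toFinset] at hx
      rw [Fintype.mem_piFinset]
      intro j
      by_cases hj : j = j₀
      · simp [f, hj]
      · rw [if_neg hj, Finset.mem_range]
        simpa [f, hj] using (hR.lt_of_notMem hx.2 j).trans_eq hL.symm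
    refine (Finset.card_le_card hsub).trans_eq ?_
    rw [Fintype.card_piFinset, ← Finset.mul_prod_erase _ _ (Finset.mem_univ j₀),
      Finset.prod_congr rfl (g := fun _ => L)]
    · simp
    · intro j hj
      simp [Finset.ne_of_mem_erase hj]
  have hLle : L ≤ R * (∑ i, p i + 1) * (∑ i, k i + 1) := by
    rw [hL, mul_assoc]
    refine Nat.mul_le_mul_left _ ?_
    simp only [Pi.add_apply, Finset.sum_add_distrib]
    nlinarith [Nat.zero_le ((∑ i, p i) * ∑ i, k i)]
  calc hfin.toFinset.card ≤ (R * ∑ i, p i) * (hfin.toFinset.image f).card :=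
        Finset.card_le_mul_card_image _ _ hfib
    _ ≤ (R * ∑ i, p i) * (R * (∑ i, p i + 1) * (∑ i, k i + 1)) ^ (n - 1) :=
        Nat.mul_le_mul_left _ (himg.trans (Nat.pow_le_pow_left hLle _))
    _ = _ := by rw [mul_pow]; ring

end powerIdeal

/-! ### Mixed differences -/

/-- The mixed difference of `G` at `k` in the directions `w i`, `i ∈ S`, with step `t`. -/
def mixedDiff {ι κ : Type*} (t : ℕ) (S : Finset κ) (w : κ → ι → ℕ) (G : (ι → ℕ) → ℤ)
    (k : ι → ℕ) : ℤ :=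
  ∑ J ∈ S.powerset, (-1) ^ (S.card - J.card) * G (k + t • ∑ i ∈ J, w i)

section mixedDiff

variable {ι κ : Type*}

theorem mixedDiff_insert [DecidableEq κ] (t : ℕ) {S : Finset κ} {i : κ} (hi : i ∉ S)
    (w : κ → ι → ℕ) (G : (ι → ℕ) → ℤ) (k : ι → ℕ) :
    mixedDiff t (insert i S) w G k = mixedDiff t S w (fun k => G (k + t • w i) - G k) k := by
  rw [mixedDiff, Finset.sum_powerset_insert hi, ← Finset.sum_add_distrib, mixedDiff]
  refine Finset.sum_congr rfl fun J hJ => ?_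
  rw [Finset.mem_powerset] at hJ
  have hiJ : i ∉ J := fun h => hi (hJ h)
  have hcard := Finset.card_le_card hJ
  rw [Finset.card_insert_of_notMem hi, Finset.card_insert_of_notMem hiJ,
    Nat.add_sub_add_right, Nat.succ_sub hcard, pow_succ, Finset.sum_insert hiJ, smul_add,
    add_assoc k, add_comm (t • ∑ i ∈ J, w i)]
  ring

theorem mixedDiff_sum (t : ℕ) (S : Finset κ) (w : κ → ι → ℕ) {ρ : Type*} (s : Finset ρ)
    (G : ρ → (ι → ℕ) → ℤ) (k : ι → ℕ) :
    mixedDiff t S w (fun k => ∑ r ∈ s, G r k) k = ∑ r ∈ s, mixedDiff t S w (G r) k := by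
  simp only [mixedDiff, Finset.mul_sum]
  exact Finset.sum_comm

theorem mixedDiff_add (t : ℕ) (S : Finset κ) (w : κ → ι → ℕ) (G H : (ι → ℕ) → ℤ) (k : ι → ℕ) :
    mixedDiff t S w (fun k => G k + H k) k = mixedDiff t S w G k + mixedDiff t S w H k := by
  simp only [mixedDiff, mul_add, Finset.sum_add_distrib]

theorem mixedDiff_sub (t : ℕ) (S : Finset κ) (w : κ → ι → ℕ) (G H : (ι → ℕ) → ℤ) (k : ι → ℕ) :
    mixedDiff t S w (fun k => G k - H k) k = mixedDiff t S w G k - mixedDiff t S w H k := by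
  simp only [mixedDiff, mul_sub, Finset.sum_sub_distrib]

theorem mixedDiff_shift (t : ℕ) (S : Finset κ) (w : κ → ι → ℕ) (G : (ι → ℕ) → ℤ)
    (v k : ι → ℕ) : mixedDiff t S w (fun k => G (k + v)) k = mixedDiff t S w G (k + v) := by
  simp only [mixedDiff, add_right_comm]

theorem mixedDiff_zero (t : ℕ) (S : Finset κ) (w : κ → ι → ℕ) (k : ι → ℕ) :
    mixedDiff t S w (fun _ => 0) k = 0 := by
  simp [mixedDiff]

theorem mixedDiff_congr (t : ℕ) (S : Finset κ) {w w' : κ → ι → ℕ} (hw : ∀ i ∈ S, w i = w' i)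
    (G : (ι → ℕ) → ℤ) (k : ι → ℕ) : mixedDiff t S w G k = mixedDiff t S w' G k := by
  refine Finset.sum_congr rfl fun J hJ => ?_
  rw [Finset.sum_congr rfl fun i hi => hw i (Finset.mem_powerset.1 hJ hi)]

/-- A mixed difference with step `t` is the sum of the mixed differences with step `1` over a box
of side `t`. -/
theorem mixedDiff_eq_pow_mul [DecidableEq κ] (t : ℕ) (S : Finset κ) (w : κ → ι → ℕ)
    (G : (ι → ℕ) → ℤ) (K : ι → ℕ) (c : ℤ) (h : ∀ k ≥ K, mixedDiff 1 S w G k = c) :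
    ∀ k ≥ K, mixedDiff t S w G k = t ^ S.card * c := by
  induction S using Finset.induction_on generalizing G with
  | empty =>
    intro k hk
    simpa [mixedDiff] using h k hk
  | insert i S hi ih =>
    intro k hk
    have h' : ∀ k ≥ K, mixedDiff 1 S w (fun k => G (k + w i) - G k) k = c := fun k hk => by
      simpa [mixedDiff_insert 1 hi] using h k hk
    have htel : ∀ k, G (k + t • w i) - G k =
        ∑ r ∈ Finset.range t, (G (k + r • w i + w i) - G (k + r • w i)) := by
      intro k
      have := Finset.sum_range_sub (fun r => G (k + r • w i)) t
      simp only [zero_smul, add_zero, succ_nsmul, ← add_assoc] at this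
      exact this.symm
    rw [mixedDiff_insert t hi]
    simp only [htel]
    rw [mixedDiff_sum, Finset.card_insert_of_notMem hi, pow_succ, Finset.sum_congr rfl
      (g := fun _ => (t : ℤ) ^ S.card * c)]
    · simp only [Finset.sum_const, Finset.card_range, nsmul_eq_mul]
      ring
    · intro r _
      rw [mixedDiff_shift t S w (fun k => G (k + w i) - G k)]
      exact ih _ h' _ (hk.trans le_self_add)

/-- The mixed difference of order `#S` of a product of binomial coefficients of total degree at
most `#S` is a constant natural number: by Pascal's rule, taking the difference in one direction
lowers one of the degrees by one, or gives zero. -/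
theorem mixedDiff_prod_choose [Fintype ι] [DecidableEq ι] [DecidableEq κ] (S : Finset κ)
    (σ : κ → ι) (a e : ι → ℕ) (he : ∑ i, e i ≤ S.card) :
    ∃ c : ℕ, ∀ k, mixedDiff 1 S (fun i => Pi.single (σ i) 1)
      (fun k => ((∏ i, (k i + a i).choose (e i) : ℕ) : ℤ)) k = c := by
  induction S using Finset.induction_on generalizing e with
  | empty =>
    have : ∀ i, e i = 0 := fun i => by
      simpa using Finset.sum_eq_zero_iff.1 (Nat.le_zero.1 he) i (Finset.mem_univ i)
    exact ⟨1, fun k => by simp [mixedDiff, this]⟩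
  | insert i S hi ih =>
    have hdiff : ∀ k : ι → ℕ,
        ((∏ l, ((k + 1 • (Pi.single (σ i) 1 : ι → ℕ)) l + a l).choose (e l) : ℕ) : ℤ) -
          ((∏ l, (k l + a l).choose (e l) : ℕ) : ℤ) =
        (((k (σ i) + 1 + a (σ i)).choose (e (σ i)) : ℕ) -
            ((k (σ i) + a (σ i)).choose (e (σ i)) : ℕ)) *
          ((∏ l ∈ Finset.univ.erase (σ i), (k l + a l).choose (e l) : ℕ) : ℤ) := by
      intro k
      rw [← Finset.mul_prod_erase _ _ (Finset.mem_univ (σ i)),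
        ← Finset.mul_prod_erase _ _ (Finset.mem_univ (σ i)), sub_mul]
      push_cast
      congr 2
      · simp
      · refine Finset.prod_congr rfl fun l hl => ?_
        simp [Finset.ne_of_mem_erase hl]
    simp only [mixedDiff_insert 1 hi, hdiff]
    rcases Nat.eq_zero_or_eq_succ_pred (e (σ i)) with h0 | h1
    · refine ⟨0, fun k => ?_⟩
      simp [h0, mixedDiff_zero]
    · set d := (e (σ i)).pred with hd
      have hsum : ∑ l, Function.update e (σ i) d l + 1 = ∑ l, e l := by
        have hother : ∑ l ∈ Finset.univ.erase (σ i), Function.update e (σ i) d l =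
            ∑ l ∈ Finset.univ.erase (σ i), e l := Finset.sum_congr rfl fun l hl =>
          Function.update_of_ne (Finset.ne_of_mem_erase hl) d e
        rw [← Finset.add_sum_erase _ e (Finset.mem_univ (σ i)),
          ← Finset.add_sum_erase _ (Function.update e (σ i) d) (Finset.mem_univ (σ i)), h1,
          Function.update_self, hother]
        omega
      obtain ⟨c, hc⟩ := ih (Function.update e (σ i) d) (by
        rw [Finset.card_insert_of_notMem hi] at he
        omega)
      refine ⟨c, fun k => ?_⟩
      rw [← hc k]
      congr 1
      ext k
      rw [← Finset.mul_prod_erase _ _ (Finset.mem_univ (σ i)), Function.update_self, h1,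
        add_right_comm, Nat.choose_succ_succ]
      push_cast
      rw [add_sub_cancel_right]
      congr 1
      refine Finset.prod_congr rfl fun l hl => ?_
      rw [Function.update_of_ne (Finset.ne_of_mem_erase hl)]

/-- A product of binomial coefficients of total degree `∑ i, e i` has growth of exactly this order
along the diagonal. -/
theorem sum_le_of_prod_choose_le [Fintype ι] {a e K : ι → ℕ} {C d : ℕ}
    (h : ∀ k : ι → ℕ, ∏ i, (k i + a i).choose (e i) ≤ C * (∑ i, (K + k) i + 1) ^ d) :
    ∑ i, e i ≤ d := by
  by_contra! hlt
  have hlow : ∀ t : ℕ, (t + 1) ^ ∑ i, e i ≤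
      (∏ i, (e i)!) * ∏ i, ((t + e i) + a i).choose (e i) := by
    intro t
    rw [← Finset.prod_pow_eq_pow_sum, ← Finset.prod_mul_distrib]
    refine Finset.prod_le_prod' fun i _ => ?_
    rw [← Nat.descFactorial_eq_factorial_mul_choose]
    refine le_trans (Nat.pow_le_pow_left ?_ _) (Nat.pow_sub_le_descFactorial _ _)
    omega
  set B := ∑ i, K i + Fintype.card ι + ∑ i, e i + 1 with hB
  have hup : ∀ t : ℕ, ∑ i, (K + fun i => t + e i) i + 1 ≤ B * (t + 1) := by
    intro t
    simp only [Pi.add_apply, Finset.sum_add_distrib, Finset.sum_const, Finset.card_univ,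
      smul_eq_mul, hB]
    nlinarith [Nat.zero_le (∑ i, K i * t), Nat.zero_le ((∑ i, K i) * t),
      Nat.zero_le ((∑ i, e i) * t)]
  set C' := (∏ i, (e i)!) * (C * B ^ d) with hC'
  have hall : ∀ t : ℕ, (t + 1) ^ (d + 1) ≤ C' * (t + 1) ^ d := by
    intro t
    calc (t + 1) ^ (d + 1) ≤ (t + 1) ^ ∑ i, e i := Nat.pow_le_pow_right (Nat.succ_pos _) hlt
      _ ≤ _ := hlow t
      _ ≤ (∏ i, (e i)!) * (C * (B * (t + 1)) ^ d) :=
          Nat.mul_le_mul_left _ ((h _).trans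
            (Nat.mul_le_mul_left _ (Nat.pow_le_pow_left (hup t) d)))
      _ = C' * (t + 1) ^ d := by rw [mul_pow, hC']; ring
  have := hall C'
  rw [pow_succ, mul_comm] at this
  have := Nat.le_of_mul_le_mul_right this (by positivity)
  omega

/-- If a sum of products of binomial coefficients has growth of order at most `#S`, so does each
of its summands, and hence its mixed difference of order `#S` is eventually a constant natural
number. -/
theorem IsBinomialSum.mixedDiff_eventually_const [Fintype ι] [DecidableEq ι] [DecidableEq κ]
    {f : (ι → ℕ) → ℕ} (hf : IsBinomialSum f) (S : Finset κ) (σ : κ → ι) {C : ℕ}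
    (hC : ∀ k, f k ≤ C * (∑ i, k i + 1) ^ S.card) :
    ∃ (c : ℕ) (K : ι → ℕ), ∀ k ≥ K,
      mixedDiff 1 S (fun i => Pi.single (σ i) 1) (fun k => (f k : ℤ)) k = c := by
  obtain ⟨K, L, hL⟩ := hf
  have hterm : ∀ p ∈ L, ∑ i, p.2 i ≤ S.card := by
    intro p hp
    refine sum_le_of_prod_choose_le (a := p.1) (K := K) (C := C) fun k => ?_
    refine le_trans ?_ (hC (K + k))
    rw [hL]
    exact List.single_le_sum (fun _ _ => Nat.zero_le _) _ (List.mem_map_of_mem hp)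
  have hsum : ∀ L : List ((ι → ℕ) × (ι → ℕ)), (∀ p ∈ L, ∑ i, p.2 i ≤ S.card) →
      ∃ c : ℕ, ∀ k, mixedDiff 1 S (fun i => Pi.single (σ i) 1)
        (fun k => (((L.map fun p => ∏ i, (k i + p.1 i).choose (p.2 i)).sum : ℕ) : ℤ)) k = c := by
    intro L
    induction L with
    | nil => exact fun _ => ⟨0, fun k => by simp [mixedDiff_zero]⟩
    | cons p L ih =>
      intro h
      obtain ⟨c, hc⟩ := ih fun p hp => h p (List.mem_cons_of_mem _ hp)
      obtain ⟨c', hc'⟩ := mixedDiff_prod_choose S σ p.1 p.2 (h p List.mem_cons_self)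
      refine ⟨c' + c, fun k => ?_⟩
      rw [Nat.cast_add, ← hc k, ← hc' k, ← mixedDiff_add]
      simp
  obtain ⟨c, hc⟩ := hsum L hterm
  refine ⟨c, K, fun k hk => ?_⟩
  obtain ⟨k, rfl⟩ := exists_add_of_le hk
  rw [← hc k, add_comm, ← mixedDiff_shift]
  congr 1
  ext k
  rw [add_comm, hL]

end mixedDiff

/-! ### Mixed multiplicities of monomial ideals -/

/-- The number of monomials not in the ideal `∏ i, Iᵢ ^ kᵢ`. -/
noncomputable def colength {N n : ℕ} {ι : Type*} [DecidableEq ι] (a : Fin N → Fin n → ℕ)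
    (c : Fin N → ι) (k : ι → ℕ) : ℤ :=
  (powerIdeal a c k)ᶜ.ncard

/-- For `I^p ⊆ I^q` the function `colength (k + p) - colength (k + q)` is the Hilbert function of the
module `⨁ₖ Iᵏ⁺ᑫ / Iᵏ⁺ᵖ`, so that its mixed differences of order `n - 1` are eventually constant
natural numbers. -/
theorem mixedDiff_colength_sub_eventually_const {N n : ℕ} {ι κ : Type*} [Fintype ι]
    [DecidableEq ι] [DecidableEq κ] {a : Fin N → Fin n → ℕ} {c : Fin N → ι} {R : ℕ}
    (hR : HasAxisGenerators a c R) (j₀ : Fin n) {p q : ι → ℕ}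
    (hpq : powerIdeal a c p ⊆ powerIdeal a c q) (S : Finset κ) (hS : S.card = n - 1) (σ : κ → ι) :
    ∃ (m : ℕ) (K : ι → ℕ), ∀ k ≥ K, mixedDiff 1 S (fun i => Pi.single (σ i) 1)
      (fun k => colength a c (k + p) - colength a c (k + q)) k = m := by
  obtain ⟨C, hC⟩ := ncard_sdiff_le hR j₀ p q
  obtain ⟨m, K, h⟩ := (isBinomialSum_ncard_sdiff hR p q).mixedDiff_eventually_const S σ
    (C := C) (by simpa [hS] using hC)
  refine ⟨m, K, fun k hk => ?_⟩
  rw [← h k hk]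
  congr 1
  ext k
  have hsub : powerIdeal a c (k + p) ⊆ powerIdeal a c (k + q) := by
    intro x hx
    obtain ⟨u, hu, h⟩ := mem_powerIdeal_add_iff.1 hx
    exact mem_powerIdeal_add_iff.2 ⟨u, hpq hu, h⟩
  have hun : (powerIdeal a c (k + p))ᶜ =
      (powerIdeal a c (k + q))ᶜ ∪ (powerIdeal a c (k + q) \ powerIdeal a c (k + p)) := by
    ext x
    have := @hsub x
    simp only [Set.mem_compl_iff, Set.mem_union, Set.mem_sdiff]
    tauto
  rw [colength, colength, hun, Set.ncard_union_eq _ (hR.finite_compl _)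
    ((hR.finite_compl (k + p)).subset fun x hx => hx.2)]
  · push_cast
    ring
  · rw [Set.disjoint_left]
    exact fun x h1 h2 => h1 h2.1

/-! ### Newton polyhedra and the volumes of their complements -/

/-- The embedding of `ℕⁿ` into `ℝⁿ`. -/
def toReal {n : ℕ} (x : Fin n → ℕ) : Fin n → ℝ := fun i => (x i : ℝ)

/-- The Newton polyhedron `conv A + ℝⁿ_{≥0}` of a set `A` of exponents. -/
def newtonPolyhedron {n : ℕ} (A : Set (Fin n → ℕ)) : Set (Fin n → ℝ) :=
  convexHull ℝ (toReal '' A) + orthant n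

section Newton

variable {n : ℕ}

theorem mem_orthant {x : Fin n → ℝ} : x ∈ orthant n ↔ 0 ≤ x := Iff.rfl

theorem toReal_add (x y : Fin n → ℕ) : toReal (x + y) = toReal x + toReal y := by
  ext i
  simp [toReal]

theorem toReal_nonneg (x : Fin n → ℕ) : 0 ≤ toReal x := fun i => Nat.cast_nonneg (x i)

theorem toReal_le_toReal {x y : Fin n → ℕ} : toReal x ≤ toReal y ↔ x ≤ y := by
  simp [toReal, Pi.le_def]

theorem mem_newtonPolyhedron {A : Set (Fin n → ℕ)} {x : Fin n → ℝ} :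
    x ∈ newtonPolyhedron A ↔ ∃ y ∈ convexHull ℝ (toReal '' A), y ≤ x := by
  constructor
  · rintro ⟨y, hy, z, hz, rfl⟩
    exact ⟨y, hy, le_add_of_nonneg_right hz⟩
  · rintro ⟨y, hy, hyx⟩
    exact ⟨y, hy, x - y, sub_nonneg.2 hyx, add_sub_cancel y x⟩

theorem convex_orthant (n : ℕ) : Convex ℝ (orthant n) := convex_Ici (𝕜 := ℝ) (0 : Fin n → ℝ)

theorem nonneg_of_mem_convexHull_toReal {A : Set (Fin n → ℕ)} {y : Fin n → ℝ}
    (hy : y ∈ convexHull ℝ (toReal '' A)) : 0 ≤ y := by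
  refine (convexHull_min ?_ (convex_orthant n) hy : y ∈ orthant n)
  rintro _ ⟨x, -, rfl⟩
  exact toReal_nonneg x

theorem sum_orthant {κ : Type*} {J : Finset κ} (hJ : J.Nonempty) :
    ∑ _i ∈ J, orthant n = orthant n := by
  classical
  refine Set.Subset.antisymm ?_ ?_
  · intro x hx
    obtain ⟨g, hg, rfl⟩ := (Set.mem_finsetSum _ _ _).1 hx
    exact mem_orthant.2 (Finset.sum_nonneg fun i hi => mem_orthant.1 (hg hi))
  · intro x hx
    obtain ⟨i, hi⟩ := hJ
    refine (Set.mem_finsetSum _ _ _).2 ⟨Pi.single i x, fun {j} _ => ?_, ?_⟩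
    · by_cases h : j = i
      · subst h
        simpa using hx
      · simp [h, mem_orthant]
    · simp [hi]

theorem mem_sum_newtonPolyhedron {κ : Type*} {J : Finset κ} (hJ : J.Nonempty)
    {A : κ → Set (Fin n → ℕ)} {x : Fin n → ℝ} :
    x ∈ ∑ i ∈ J, newtonPolyhedron (A i) ↔
      ∃ y : κ → Fin n → ℝ, (∀ i ∈ J, y i ∈ convexHull ℝ (toReal '' A i)) ∧ ∑ i ∈ J, y i ≤ x := by
  classical
  rw [Set.mem_finsetSum]
  constructor
  · rintro ⟨g, hg, rfl⟩
    choose! y hy hle using fun i (hi : i ∈ J) => mem_newtonPolyhedron.1 (hg hi)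
    exact ⟨y, hy, Finset.sum_le_sum hle⟩
  · rintro ⟨y, hy, hle⟩
    obtain ⟨i, hi⟩ := hJ
    refine ⟨fun j => y j + (Pi.single i (x - ∑ i ∈ J, y i) : κ → Fin n → ℝ) j, fun {j} hj =>
      mem_newtonPolyhedron.2 ⟨y j, hy j hj, le_add_of_nonneg_right ?_⟩, ?_⟩
    · by_cases h : j = i
      · subst h
        simpa using hle
      · simp [h]
    · simp [Finset.sum_add_distrib, hi]

theorem sum_newtonPolyhedron_subset_orthant {κ : Type*} {J : Finset κ}
    (A : κ → Set (Fin n → ℕ)) (hJ : J.Nonempty) :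
    ∑ i ∈ J, newtonPolyhedron (A i) ⊆ orthant n := by
  intro x hx
  obtain ⟨y, hy, hle⟩ := (mem_sum_newtonPolyhedron hJ).1 hx
  exact (Finset.sum_nonneg fun i hi => nonneg_of_mem_convexHull_toReal (hy i hi)).trans hle

/-- The complement in the orthant of a union of translated orthants with vertices in `ℕⁿ` is a
union of lattice cubes. -/
theorem volume_orthant_diff {I : Set (Fin n → ℕ)} (hI : IsUpperSet I) (hfin : Iᶜ.Finite) :
    MeasureTheory.volume {x | x ∈ orthant n ∧ ¬ ∃ z ∈ I, toReal z ≤ x} = Iᶜ.ncard := by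
  classical
  have hset : {x | x ∈ orthant n ∧ ¬ ∃ z ∈ I, toReal z ≤ x} =
      ⋃ z ∈ hfin.toFinset, Set.pi Set.univ fun i => Set.Ico (z i : ℝ) (z i + 1) := by
    ext x
    simp only [Set.mem_ofPred_eq, Set.mem_iUnion, Set.Finite.mem_toFinset, exists_prop,
      Set.mem_univ_pi, Set.mem_Ico, mem_orthant]
    constructor
    · rintro ⟨h0, h⟩
      refine ⟨fun i => ⌊x i⌋₊, fun hz => h ⟨_, hz, fun i => Nat.floor_le (h0 i)⟩, fun i =>
        ⟨Nat.floor_le (h0 i), Nat.lt_floor_add_one (x i)⟩⟩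
    · rintro ⟨z, hz, h⟩
      refine ⟨fun i => (Nat.cast_nonneg (z i)).trans (h i).1, ?_⟩
      rintro ⟨z', hz', hle⟩
      refine hz (hI (fun i => ?_) hz')
      have : (z' i : ℝ) < z i + 1 := (hle i).trans_lt (h i).2
      exact Nat.lt_succ_iff.1 (by exact_mod_cast this)
  rw [hset, MeasureTheory.measure_biUnion_finset]
  · simp only [Real.volume_pi_Ico, add_sub_cancel_left, ENNReal.ofReal_one, Finset.prod_const_one,
      Finset.sum_const, nsmul_eq_mul, mul_one]
    rw [Set.ncard_eq_toFinset_card _ hfin]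
  · intro z _ z' _ hne
    rw [Function.onFun, Set.disjoint_left]
    intro x hx hx'
    simp only [Set.mem_univ_pi, Set.mem_Ico] at hx hx'
    refine hne (funext fun i => ?_)
    have h1 : (z i : ℝ) < z' i + 1 := (hx i).1.trans_lt (hx' i).2
    have h2 : (z' i : ℝ) < z i + 1 := (hx' i).1.trans_lt (hx i).2
    have h1' : z i < z' i + 1 := by exact_mod_cast h1
    have h2' : z' i < z i + 1 := by exact_mod_cast h2
    omega
  · exact fun z _ => MeasurableSet.univ_pi fun i => measurableSet_Ico

variable {N : ℕ} {ι : Type*} {a : Fin N → Fin n → ℕ} {c : Fin N → ι}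

/-- The exponents of the generators of the ideal of index `i`. -/
def generators (a : Fin N → Fin n → ℕ) (c : Fin N → ι) (i : ι) : Set (Fin n → ℕ) :=
  a '' (c ⁻¹' {i})

theorem toReal_weight (α : Fin N → ℕ) :
    toReal (weight a α) = ∑ l, (α l : ℝ) • toReal (a l) := by
  ext j
  simp [toReal, weight]

theorem exists_weights_of_mem_convexHull {i : ι} {y : Fin n → ℝ}
    (hy : y ∈ convexHull ℝ (toReal '' generators a c i)) :
    ∃ lam : Fin N → ℝ, (∀ l, 0 ≤ lam l) ∧ (∀ l, c l ≠ i → lam l = 0) ∧ ∑ l, lam l = 1 ∧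
      ∑ l, lam l • toReal (a l) = y := by
  classical
  let T : Set (Fin n → ℝ) := {y | ∃ lam : Fin N → ℝ, (∀ l, 0 ≤ lam l) ∧
    (∀ l, c l ≠ i → lam l = 0) ∧ ∑ l, lam l = 1 ∧ ∑ l, lam l • toReal (a l) = y}
  have hT : Convex ℝ T := by
    rintro _ ⟨f, hf0, hf1, hf2, rfl⟩ _ ⟨g, hg0, hg1, hg2, rfl⟩ s r hs hr hsr
    refine ⟨fun l => s * f l + r * g l, fun l => ?_, fun l hl => ?_, ?_, ?_⟩
    · have := hf0 l
      have := hg0 l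
      positivity
    · simp [hf1 l hl, hg1 l hl]
    · rw [Finset.sum_add_distrib, ← Finset.mul_sum, ← Finset.mul_sum, hf2, hg2, mul_one, mul_one,
        hsr]
    · simp only [add_smul, mul_smul, Finset.sum_add_distrib, Finset.smul_sum]
  refine convexHull_min (s := toReal '' generators a c i) (t := T) ?_ hT hy
  rintro _ ⟨_, ⟨l, hl, rfl⟩, rfl⟩
  refine ⟨Pi.single l 1, fun l' => ?_, fun l' hl' => ?_, by simp, ?_⟩
  · by_cases h : l' = l
    · subst h; simp
    · simp [h]
  · rw [Pi.single_eq_of_ne]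
    rintro rfl
    exact hl' hl
  · rw [Finset.sum_eq_single l]
    · simp
    · intro l' _ h
      simp [h]
    · simp

variable [DecidableEq ι]

theorem colorDeg_eq_smul_single {α : Fin N → ℕ} {i : ι} {t : ℕ} (hα : ∀ l, c l ≠ i → α l = 0)
    (hsum : ∑ l, α l = t) : colorDeg c α = t • Pi.single i 1 := by
  ext i'
  by_cases hi : i' = i
  · subst hi
    simp only [colorDeg, Pi.smul_apply, Pi.single_eq_same, smul_eq_mul, mul_one, ← hsum]
    rw [Finset.sum_filter]
    refine Finset.sum_congr rfl fun l _ => ?_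
    split_ifs with h
    · rfl
    · exact (hα l h).symm
  · simp only [colorDeg, Pi.smul_apply, Pi.single_eq_of_ne hi, smul_zero]
    refine Finset.sum_eq_zero fun l hl => hα l ?_
    rw [(Finset.mem_filter.1 hl).2]
    exact hi

theorem toReal_weight_mem_smul_convexHull {α : Fin N → ℕ} {i : ι} {t : ℕ} (ht : 0 < t)
    (hα : colorDeg c α = t • Pi.single i 1) :
    (t : ℝ)⁻¹ • toReal (weight a α) ∈ convexHull ℝ (toReal '' generators a c i) := by
  have hzero : ∀ l, c l ≠ i → α l = 0 := fun l hl => by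
    have := le_colorDeg c α l
    simpa [hα, hl] using this
  have hsum : ∑ l, α l = t := by
    have h1 := congrFun hα i
    simp only [colorDeg, Pi.smul_apply, Pi.single_eq_same, smul_eq_mul, mul_one,
      Finset.sum_filter] at h1
    rw [← h1]
    refine Finset.sum_congr rfl fun l _ => ?_
    split_ifs with h
    · rfl
    · exact hzero l h
  have ht' : (t : ℝ) ≠ 0 := by positivity
  rw [toReal_weight, Finset.smul_sum]
  have hS : ∑ l, (t : ℝ)⁻¹ • (α l : ℝ) • toReal (a l) =
      ∑ l with c l = i, ((t : ℝ)⁻¹ * α l) • toReal (a l) := by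
    rw [Finset.sum_filter]
    refine Finset.sum_congr rfl fun l _ => ?_
    split_ifs with h
    · rw [mul_smul]
    · simp [hzero l h]
  rw [hS]
  refine (convex_convexHull ℝ _).sum_mem (fun l _ => by positivity) ?_ fun l hl =>
    subset_convexHull ℝ _ ⟨a l, ⟨l, (Finset.mem_filter.1 hl).2, rfl⟩, rfl⟩
  rw [← Finset.mul_sum, ← Nat.cast_sum]
  have : ∑ l with c l = i, α l = t := by
    have := congrFun hα i
    simpa [colorDeg] using this
  rw [this, inv_mul_cancel₀ ht']

/-- Rounding: up to a bounded error, `t` times a point of the convex hull of the generators is a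
sum of `t` generators. -/
theorem exists_colorDeg_weight_le {i : ι} (l₀ : Fin N) (hl₀ : c l₀ = i) {y : Fin n → ℝ}
    (hy : y ∈ convexHull ℝ (toReal '' generators a c i)) (t : ℕ) :
    ∃ α, colorDeg c α = t • Pi.single i 1 ∧
      toReal (weight a α) ≤ (t : ℝ) • y + (N : ℝ) • toReal (a l₀) := by
  obtain ⟨lam, h0, hc, hsum, rfl⟩ := exists_weights_of_mem_convexHull hy
  have hfl : ∀ l, (⌊t * lam l⌋₊ : ℝ) ≤ t * lam l := fun l =>
    Nat.floor_le (mul_nonneg (Nat.cast_nonneg t) (h0 l))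
  have htsum : ∑ l, (t : ℝ) * lam l = t := by rw [← Finset.mul_sum, hsum, mul_one]
  have hle : ∑ l, ⌊t * lam l⌋₊ ≤ t := by
    have : ((∑ l, ⌊t * lam l⌋₊ : ℕ) : ℝ) ≤ t := by
      rw [Nat.cast_sum]
      exact (Finset.sum_le_sum fun l _ => hfl l).trans_eq htsum
    exact_mod_cast this
  obtain ⟨s, hs⟩ := Nat.exists_eq_add_of_le hle
  have hsN : (s : ℝ) ≤ N := by
    have h1 : (t : ℝ) ≤ ∑ l : Fin N, ((⌊t * lam l⌋₊ : ℝ) + 1) := by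
      exact htsum.symm.trans_le (Finset.sum_le_sum fun l _ => (Nat.lt_floor_add_one _).le)
    have h2 : (t : ℝ) = ∑ l, (⌊t * lam l⌋₊ : ℝ) + s := by exact_mod_cast hs
    simp only [Finset.sum_add_distrib, Finset.sum_const, Finset.card_univ, Fintype.card_fin,
      nsmul_eq_mul, mul_one] at h1
    linarith
  refine ⟨fun l => ⌊t * lam l⌋₊ + (Pi.single l₀ s : Fin N → ℕ) l,
    colorDeg_eq_smul_single ?_ ?_, ?_⟩
  · intro l hl
    have : l ≠ l₀ := by
      rintro rfl
      exact hl hl₀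
    simp [hc l hl, this]
  · rw [Finset.sum_add_distrib, Finset.sum_pi_single', if_pos (Finset.mem_univ _), ← hs]
  · rw [toReal_weight]
    simp only [Nat.cast_add, add_smul, Finset.sum_add_distrib]
    refine add_le_add ?_ ?_
    · rw [Finset.smul_sum]
      refine Finset.sum_le_sum fun l _ => ?_
      rw [smul_smul]
      exact smul_le_smul_of_nonneg_right (hfl l) (toReal_nonneg _)
    · rw [Finset.sum_eq_single l₀]
      · simpa using smul_le_smul_of_nonneg_right hsN (toReal_nonneg (a l₀))
      · intro l _ hl
        simp [hl]
      · simp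

end Newton

/-! ### Mixed volumes as mixed multiplicities -/

section limit

variable {n N : ℕ} {ι κ : Type*} [DecidableEq ι]
  {a : Fin N → Fin n → ℕ} {c : Fin N → ι}

/-- Scaled down by `t`, the exponents in `∏ i ∈ J, Iᵢ ^ t` lie in the Minkowski sum over `J` of the
Newton polyhedra. The additional factor `I^K` only makes the ideal smaller. -/
theorem exists_sum_le_of_mem_powerIdeal {K : ι → ℕ} {t : ℕ} (ht : 0 < t)
    (J : Finset κ) (σ : κ → ι) {z : Fin n → ℕ}
    (hz : z ∈ powerIdeal a c (K + t • ∑ i ∈ J, Pi.single (σ i) 1)) :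
    ∃ y : κ → Fin n → ℝ, (∀ i ∈ J, y i ∈ convexHull ℝ (toReal '' generators a c (σ i))) ∧
      ∑ i ∈ J, y i ≤ (t : ℝ)⁻¹ • toReal z := by
  classical
  have ht' : (0 : ℝ) < t := by positivity
  induction J using Finset.induction_on generalizing z with
  | empty => exact ⟨0, by simp, by simpa using smul_nonneg (by positivity) (toReal_nonneg z)⟩
  | insert i J hi ih =>
    rw [Finset.sum_insert hi, smul_add, add_left_comm, mem_powerIdeal_add_iff] at hz
    obtain ⟨u, hu, α, hα, rfl⟩ := hz
    obtain ⟨y, hy, hle⟩ := ih hu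
    refine ⟨Function.update y i ((t : ℝ)⁻¹ • toReal (weight a α)), ?_, ?_⟩
    · intro j hj
      by_cases h : j = i
      · subst h
        simpa using toReal_weight_mem_smul_convexHull ht hα
      · rw [Function.update_of_ne h]
        exact hy j (Finset.mem_of_mem_insert_of_ne hj h)
    · have hother : ∑ j ∈ J, Function.update y i ((t : ℝ)⁻¹ • toReal (weight a α)) j =
          ∑ j ∈ J, y j := Finset.sum_congr rfl fun j hj =>
        Function.update_of_ne (ne_of_mem_of_not_mem hj hi) _ y
      rw [Finset.sum_insert hi, Function.update_self, hother, toReal_add, smul_add, add_comm]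
      exact add_le_add hle le_rfl

variable [Fintype ι]

/-- Up to an error bounded independently of `t`, the `t`-fold dilates of points of the Minkowski sum
of the convex hulls are exponents in `I^K * ∏ i ∈ J, Iᵢ ^ t`. -/
theorem exists_mem_powerIdeal_le {R : ℕ} (hR : HasAxisGenerators a c R) (j₀ : Fin n)
    (K : ι → ℕ) (J : Finset κ) (σ : κ → ι) :
    ∃ r : ℝ, 0 ≤ r ∧ ∀ (t : ℕ) (y : κ → Fin n → ℝ),
      (∀ i ∈ J, y i ∈ convexHull ℝ (toReal '' generators a c (σ i))) →
      ∃ z ∈ powerIdeal a c (K + t • ∑ i ∈ J, Pi.single (σ i) 1),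
        toReal z ≤ (t : ℝ) • ∑ i ∈ J, y i + fun _ => r := by
  classical
  induction J using Finset.induction_on with
  | empty =>
    refine ⟨R * ∑ i, K i, by positivity, fun t y _ =>
      ⟨fun _ => R * ∑ i, K i, hR.mem_powerIdeal j₀ (by simp), ?_⟩⟩
    intro j
    simp [toReal]
  | insert i J hi ih =>
    obtain ⟨r, hr, h⟩ := ih
    obtain ⟨l₀, hl₀, -⟩ := hR (σ i) j₀
    refine ⟨r + N * ∑ j, (a l₀ j : ℝ), by positivity, fun t y hy => ?_⟩
    obtain ⟨z, hz, hle⟩ := h t y fun j hj => hy j (Finset.mem_insert_of_mem hj)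
    obtain ⟨α, hα, hw⟩ := exists_colorDeg_weight_le l₀ hl₀ (hy i (Finset.mem_insert_self _ _)) t
    refine ⟨z + weight a α, ?_, ?_⟩
    · have := add_mem_powerIdeal hz (weight_mem_powerIdeal (a := a) (c := c) α)
      rw [Finset.sum_insert hi, add_comm (Pi.single (σ i) 1 : ι → ℕ), smul_add, ← add_assoc]
      rwa [hα] at this
    · rw [toReal_add, Finset.sum_insert hi, smul_add]
      intro j
      have h1 := hle j
      have h2 := hw j
      have h3 : (a l₀ j : ℝ) ≤ ∑ j, (a l₀ j : ℝ) :=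
        Finset.single_le_sum (f := fun j => (a l₀ j : ℝ)) (fun _ _ => Nat.cast_nonneg _)
          (Finset.mem_univ j)
      have h4 := mul_le_mul_of_nonneg_left h3 (Nat.cast_nonneg (α := ℝ) N)
      simp only [Pi.add_apply, Pi.smul_apply, smul_eq_mul, toReal] at h1 h2 ⊢
      linarith

/-- The volume of the complement of a Minkowski sum of Newton polyhedra is the leading coefficient
of the colength of the corresponding products of ideals. -/
theorem tendsto_colength_div_pow {R : ℕ} (hR : HasAxisGenerators a c R) (j₀ : Fin n)
    (K : ι → ℕ) {J : Finset κ} (hJ : J.Nonempty) (σ : κ → ι) :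
    Filter.Tendsto (fun t : ℕ => (colength a c (K + t • ∑ i ∈ J, Pi.single (σ i) 1) : ℝ) / t ^ n)
      Filter.atTop (nhds (MeasureTheory.volume
        (orthant n \ ∑ i ∈ J, newtonPolyhedron (generators a c (σ i)))).toReal) := by
  obtain ⟨r, hr, hr'⟩ := exists_mem_powerIdeal_le hR j₀ K J σ
  set P := ∑ i ∈ J, newtonPolyhedron (generators a c (σ i)) with hP
  let k : ℕ → ι → ℕ := fun t => K + t • ∑ i ∈ J, Pi.single (σ i) 1
  let E : ℕ → Set (Fin n → ℝ) := fun t =>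
    {x | x ∈ orthant n ∧ ¬ ∃ z ∈ powerIdeal a c (k t), toReal z ≤ x}
  let L : ℕ → ℝ := fun t => R * ∑ i, (k t i : ℝ)
  have hL0 : ∀ t, 0 ≤ L t := fun t => by positivity
  have hvolE : ∀ t, MeasureTheory.volume (E t) = ((powerIdeal a c (k t))ᶜ.ncard : ENNReal) :=
    fun t => volume_orthant_diff (isUpperSet_powerIdeal _) (hR.finite_compl _)
  have hsmul : ∀ t : ℕ, MeasureTheory.volume ((t : ℝ) • (orthant n \ P)) =
      ENNReal.ofReal ((t : ℝ) ^ n) * MeasureTheory.volume (orthant n \ P) := by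
    intro t
    rw [MeasureTheory.Measure.addHaar_smul, Module.finrank_fin_fun, abs_of_nonneg (by positivity)]
  -- a point of the orthant outside `t • P` lies outside the lattice approximation of `t • P`
  have hlow : ∀ t : ℕ, 0 < t → (t : ℝ) • (orthant n \ P) ⊆ E t := by
    rintro t ht _ ⟨x, ⟨hx0, hxP⟩, rfl⟩
    have ht' : (0 : ℝ) < t := by positivity
    refine ⟨mem_orthant.2 (smul_nonneg ht'.le hx0), ?_⟩
    rintro ⟨z, hz, hzx⟩
    obtain ⟨y, hy, hle⟩ := exists_sum_le_of_mem_powerIdeal ht J σ hz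
    refine hxP ((mem_sum_newtonPolyhedron hJ).2 ⟨y, hy, hle.trans ?_⟩)
    have := smul_le_smul_of_nonneg_left hzx (inv_nonneg.2 ht'.le)
    simpa [smul_smul, inv_mul_cancel₀ ht'.ne'] using this
  -- conversely, up to a layer of bounded width along the coordinate hyperplanes and a translation
  have hup : ∀ t : ℕ, 0 < t → E t ⊆
      (Set.Icc (0 : Fin n → ℝ) (fun _ => L t + r) \ Set.Icc (fun _ => r) (fun _ => L t + r)) ∪
        ((fun _ : Fin n => r) +ᵥ ((t : ℝ) • (orthant n \ P))) := by
    rintro t ht x ⟨hx0, hx⟩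
    have ht' : (0 : ℝ) < t := by positivity
    have hxL : ∀ j, x j ≤ L t + r := by
      intro j
      by_contra! h
      refine hx ⟨Pi.single j (R * ∑ i, k t i), hR.mem_powerIdeal j (by simp), fun j' => ?_⟩
      by_cases hj : j' = j
      · subst hj
        have : L t ≤ x j' := by linarith
        simpa [toReal, L] using this
      · simpa [toReal, hj] using hx0 j'
    by_cases hxr : ∀ j, r ≤ x j
    · right
      rw [Set.mem_vadd_set]
      refine ⟨fun j => x j - r, ?_, by ext j; simp⟩
      rw [Set.mem_smul_set_iff_inv_smul_mem₀ ht'.ne']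
      refine ⟨mem_orthant.2 (smul_nonneg (inv_nonneg.2 ht'.le)
        fun j => sub_nonneg.2 (hxr j)), fun hP' => hx ?_⟩
      obtain ⟨y, hy, hle⟩ := (mem_sum_newtonPolyhedron hJ).1 hP'
      obtain ⟨z, hz, hzle⟩ := hr' t y hy
      refine ⟨z, hz, hzle.trans fun j => ?_⟩
      have := mul_le_mul_of_nonneg_left (hle j) ht'.le
      simp only [Pi.smul_apply, smul_eq_mul, ← mul_assoc, mul_inv_cancel₀ ht'.ne', one_mul]
        at this
      simp only [Pi.add_apply, Pi.smul_apply, smul_eq_mul]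
      linarith
    · exact .inl ⟨⟨hx0, hxL⟩, fun h => hxr h.1⟩
  have hfin : MeasureTheory.volume (orthant n \ P) ≠ ⊤ := by
    have h1 := MeasureTheory.measure_mono (μ := MeasureTheory.volume) (hlow 1 one_pos)
    rw [Nat.cast_one, one_smul, hvolE] at h1
    exact ne_top_of_le_ne_top (ENNReal.natCast_ne_top _) h1
  set v := (MeasureTheory.volume (orthant n \ P)).toReal with hv
  -- the layer has volume of order `t ^ (n - 1)`
  have hslab : ∀ t, MeasureTheory.volume (Set.Icc (0 : Fin n → ℝ) (fun _ => L t + r) \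
      Set.Icc (fun _ => r) (fun _ => L t + r)) =
        ENNReal.ofReal ((L t + r) ^ n - (L t) ^ n) := by
    intro t
    rw [MeasureTheory.measure_sdiff (Set.Icc_subset_Icc_left fun _ => hr)
      measurableSet_Icc.nullMeasurableSet isCompact_Icc.measure_lt_top.ne,
      Real.volume_Icc_pi, Real.volume_Icc_pi]
    simp only [Pi.zero_apply, sub_zero, Finset.prod_const, Finset.card_univ, Fintype.card_fin,
      add_sub_cancel_right]
    rw [← ENNReal.ofReal_pow (hL0 t), ← ENNReal.ofReal_pow (add_nonneg (hL0 t) hr),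
      ENNReal.ofReal_sub _ (pow_nonneg (hL0 t) n)]
  have hlow' : ∀ t : ℕ, 0 < t → v ≤ (colength a c (k t) : ℝ) / t ^ n := by
    intro t ht
    have ht' : (0 : ℝ) < t := by positivity
    rw [le_div_iff₀ (by positivity)]
    have h1 := MeasureTheory.measure_mono (μ := MeasureTheory.volume) (hlow t ht)
    rw [hsmul, hvolE] at h1
    have h2 := ENNReal.toReal_mono (ENNReal.natCast_ne_top _) h1
    rw [ENNReal.toReal_mul, ENNReal.toReal_ofReal (by positivity), ENNReal.toReal_natCast] at h2
    rw [mul_comm]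
    simpa [colength] using h2
  have hup' : ∀ t : ℕ, 0 < t → (colength a c (k t) : ℝ) / t ^ n ≤
      ((L t / t + r / t) ^ n - (L t / t) ^ n) + v := by
    intro t ht
    have ht' : (0 : ℝ) < t := by positivity
    have hpow : (L t) ^ n ≤ (L t + r) ^ n :=
      pow_le_pow_left₀ (hL0 t) (le_add_of_nonneg_right hr) n
    have h1 := (MeasureTheory.measure_mono (μ := MeasureTheory.volume) (hup t ht)).trans
      (MeasureTheory.measure_union_le _ _)
    rw [MeasureTheory.measure_vadd, hsmul, hvolE, hslab, ← ENNReal.ofReal_toReal hfin, ← hv,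
      ← ENNReal.ofReal_mul (by positivity), ← ENNReal.ofReal_add (sub_nonneg.2 hpow)
      (by positivity)] at h1
    have h2 := ENNReal.toReal_mono ENNReal.ofReal_ne_top h1
    rw [ENNReal.toReal_natCast, ENNReal.toReal_ofReal
      (add_nonneg (sub_nonneg.2 hpow) (by positivity))] at h2
    rw [div_le_iff₀ (by positivity), ← add_div, div_pow, div_pow, ← sub_div, add_mul,
      div_mul_cancel₀ _ (by positivity), mul_comm v]
    simpa [colength] using h2
  refine tendsto_of_tendsto_of_tendsto_of_le_of_le' tendsto_const_nhds ?_
    (Filter.eventually_atTop.2 ⟨1, fun t ht => hlow' t ht⟩)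
    (Filter.eventually_atTop.2 ⟨1, fun t ht => hup' t ht⟩)
  set s : ℝ := ∑ i, ((∑ i ∈ J, Pi.single (σ i) 1 : ι → ℕ) i : ℝ) with hs
  have hLt : Filter.Tendsto (fun t : ℕ => L t / t) Filter.atTop (nhds (R * s)) := by
    have h1 : Filter.Tendsto (fun t : ℕ => (R * ∑ i, (K i : ℝ)) / (t : ℝ) + R * s)
        Filter.atTop (nhds (0 + R * s)) :=
      (tendsto_const_div_atTop_nhds_zero_nat _).add tendsto_const_nhds
    rw [zero_add] at h1
    refine h1.congr' (Filter.eventually_atTop.2 ⟨1, fun t ht => ?_⟩)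
    have ht' : (t : ℝ) ≠ 0 := by positivity
    simp only [L, k, Pi.add_apply, Pi.smul_apply, smul_eq_mul, Nat.cast_add, Nat.cast_mul,
      Finset.sum_add_distrib, ← Finset.mul_sum, ← hs]
    field_simp
  have hrt : Filter.Tendsto (fun t : ℕ => r / (t : ℝ)) Filter.atTop (nhds 0) :=
    tendsto_const_div_atTop_nhds_zero_nat r
  have := (((hLt.add hrt).pow n).sub (hLt.pow n)).add (tendsto_const_nhds (x := v))
  simpa using this

theorem pairVolume_sum_newtonPolyhedron {J : Finset κ} (hJ : J.Nonempty)
    (A : κ → Set (Fin n → ℕ)) :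
    pairVolume (∑ _i ∈ J, orthant n) (∑ i ∈ J, newtonPolyhedron (A i)) =
      (n ! : ℝ) * (MeasureTheory.volume
        (orthant n \ ∑ i ∈ J, newtonPolyhedron (A i))).toReal := by
  rw [pairVolume, sum_orthant hJ,
    Set.sdiff_eq_empty.2 (sum_newtonPolyhedron_subset_orthant A hJ)]
  simp

theorem pairVolume_self (A : Set (Fin n → ℝ)) : pairVolume A A = 0 := by
  simp [pairVolume]

/-- If the mixed difference of the colength is eventually the constant `m`, then `m` is the
relative mixed volume of the Newton polyhedra. -/
theorem relMixedVolume_newtonPolyhedron {R : ℕ} (hR : HasAxisGenerators a c R) (j₀ : Fin n)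
    (σ : Fin n → ι) {m : ℤ} {K : ι → ℕ}
    (h : ∀ k ≥ K, mixedDiff 1 Finset.univ (fun i => Pi.single (σ i) 1) (colength a c) k = m) :
    relMixedVolume (fun i => newtonPolyhedron (generators a c (σ i))) = m := by
  have hn : n ≠ 0 := fun h => by subst h; exact j₀.elim0
  have hterm : ∀ J : Finset (Fin n), Filter.Tendsto
      (fun t : ℕ => (colength a c (K + t • ∑ i ∈ J, Pi.single (σ i) 1) : ℝ) / t ^ n)
      Filter.atTop (nhds (1 / (n ! : ℝ) * pairVolume (∑ _i ∈ J, orthant n)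
        (∑ i ∈ J, newtonPolyhedron (generators a c (σ i))))) := by
    intro J
    rcases J.eq_empty_or_nonempty with rfl | hJ
    · simp only [Finset.sum_empty, smul_zero, add_zero, pairVolume_self, mul_zero]
      exact tendsto_const_nhds.div_atTop
        ((Filter.tendsto_pow_atTop hn).comp tendsto_natCast_atTop_atTop)
    · rw [pairVolume_sum_newtonPolyhedron hJ, ← mul_assoc, one_div,
        inv_mul_cancel₀ (by positivity), one_mul]
      exact tendsto_colength_div_pow hR j₀ K hJ σ
  have hsum := tendsto_finsetSum (Finset.univ : Finset (Finset (Fin n))) fun J _ =>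
    (hterm J).const_mul ((-1 : ℝ) ^ (n - J.card))
  have hlim : Filter.Tendsto (fun t : ℕ => ∑ J : Finset (Fin n), (-1 : ℝ) ^ (n - J.card) *
      ((colength a c (K + t • ∑ i ∈ J, Pi.single (σ i) 1) : ℝ) / t ^ n))
      Filter.atTop (nhds (m : ℝ)) := by
    refine tendsto_const_nhds.congr' (Filter.eventually_atTop.2 ⟨1, fun t ht => ?_⟩)
    have ht' : (t : ℝ) ≠ 0 := by positivity
    have h1 := mixedDiff_eq_pow_mul t Finset.univ (fun i => Pi.single (σ i) 1) (colength a c)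
      K m h K le_rfl
    rw [mixedDiff, Finset.powerset_univ, Finset.card_univ, Fintype.card_fin] at h1
    have h2 := congrArg (Int.cast : ℤ → ℝ) h1
    push_cast at h2
    simp only [← mul_div_assoc]
    rw [← Finset.sum_div, h2, mul_div_cancel_left₀ _ (by positivity)]
  rw [tendsto_nhds_unique hlim hsum, relMixedVolume, mixedVolume, Finset.mul_sum]
  exact Finset.sum_congr rfl fun J _ => by ring

end limit

/-! ### Integrality, monotonicity and concavity of the relative mixed volume -/

/-- A finite set of exponents that contains a point on each coordinate axis. -/
structure IsAxial {n : ℕ} (A : Set (Fin n → ℕ)) : Prop where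
  finite : A.Finite
  axis : ∀ j, ∃ r, Pi.single j r ∈ A

section core

variable {n : ℕ}

/-- A finite family of axial sets, listed as a coloured sequence of generators. -/
theorem exists_generators {ι : Type*} [Fintype ι] {A : ι → Set (Fin n → ℕ)}
    (hA : ∀ i, IsAxial (A i)) : ∃ (N : ℕ) (a : Fin N → Fin n → ℕ) (c : Fin N → ι) (R : ℕ),
      HasAxisGenerators a c R ∧ ∀ i, generators a c i = A i := by
  classical
  have hfin : ∀ i, Finite (A i) := fun i => (hA i).finite.to_subtype
  have : Fintype (Σ i, A i) := Fintype.ofFinite _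
  let e := (Fintype.equivFin (Σ i, A i)).symm
  have hval : ∀ s, ((e (e.symm s)).2 : Fin n → ℕ) = s.2 := fun s => by rw [e.apply_symm_apply]
  choose r hr using fun i => (hA i).axis
  refine ⟨_, fun l => (e l).2, fun l => (e l).1, ∑ i, ∑ j, r i j, fun i j => ?_, fun i => ?_⟩
  · refine ⟨e.symm ⟨i, _, hr i j⟩, by simp, ?_⟩
    refine (hval _).trans_le (single_le_of_le_apply ?_)
    rw [Pi.single_eq_same]
    exact (Finset.single_le_sum (f := fun j => r i j) (fun _ _ => Nat.zero_le _)
      (Finset.mem_univ j)).trans (Finset.single_le_sum (f := fun i => ∑ j, r i j)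
        (fun _ _ => Nat.zero_le _) (Finset.mem_univ i))
  · ext x
    constructor
    · rintro ⟨l, rfl, rfl⟩
      exact (e l).2.2
    · intro hx
      exact ⟨e.symm ⟨i, x, hx⟩, by simp, hval _⟩

theorem mem_powerIdeal_single {N : ℕ} {ι : Type*} [DecidableEq ι]
    {a : Fin N → Fin n → ℕ} {c : Fin N → ι} {i : ι} {z : Fin n → ℕ} :
    z ∈ powerIdeal a c (Pi.single i 1) ↔ ∃ g ∈ generators a c i, g ≤ z := by
  classical
  constructor
  · rintro ⟨α, hα, hle⟩
    have hne : ∑ l with c l = i, α l ≠ 0 := by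
      have := congrFun hα i
      simp only [colorDeg, Pi.single_eq_same] at this
      omega
    obtain ⟨l, hl, hl0⟩ := Finset.exists_ne_zero_of_sum_ne_zero hne
    refine ⟨a l, ⟨l, (Finset.mem_filter.1 hl).2, rfl⟩, le_trans ?_ hle⟩
    calc a l ≤ α l • a l := fun j =>
          Nat.le_mul_of_pos_left (a l j) (Nat.pos_of_ne_zero hl0)
      _ ≤ weight a α := Finset.single_le_sum (f := fun l => α l • a l)
          (fun _ _ _ => Nat.zero_le _) (Finset.mem_univ l)
  · rintro ⟨_, ⟨l, hl, rfl⟩, hle⟩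
    refine ⟨Pi.single l 1, ?_, ?_⟩
    · have := colorDeg_eq_smul_single (c := c) (α := Pi.single l 1) (i := i) (t := 1)
        (fun l' hl' => Pi.single_eq_of_ne (fun h => hl' (by rw [h]; exact hl)) _) (by simp)
      simpa using this
    · refine le_trans (le_of_eq ?_) hle
      rw [weight, Finset.sum_eq_single l]
      · simp
      · intro l' _ h
        simp [h]
      · simp

/-- The relative mixed volumes obtained by inserting Newton polyhedra `X x` into a fixed place of
a tuple of Newton polyhedra are natural numbers; they decrease when the ideal generated by `X x`
increases, and they satisfy a concavity inequality when the square of one ideal is contained in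
the product of two others. All these numbers are read off from the colength of products of powers
of the ideals generated by all the `X x` and `A i`. -/
theorem exists_relMixedVolume_eq {κ : Type*} [Fintype κ] {X : κ → Set (Fin n → ℕ)}
    {A : Fin n → Set (Fin n → ℕ)} (hX : ∀ x, IsAxial (X x)) (hA : ∀ i, IsAxial (A i))
    (i₀ : Fin n) :
    ∃ m : κ → ℕ, (∀ x, relMixedVolume (Function.update (fun i => newtonPolyhedron (A i)) i₀
        (newtonPolyhedron (X x))) = m x) ∧
      (∀ x y, (∀ z ∈ X x, ∃ g ∈ X y, g ≤ z) → m y ≤ m x) ∧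
      (∀ x y y', (∀ z ∈ X x, ∀ z' ∈ X x, ∃ g ∈ X y, ∃ g' ∈ X y', g + g' ≤ z + z') →
        m y + m y' ≤ 2 * m x) := by
  classical
  obtain ⟨N, a, c, R, hR, hgen⟩ := exists_generators (A := Sum.elim X A) (by
    rintro (x | i)
    · exact hX x
    · exact hA i)
  let S := Finset.univ.erase i₀
  have hS : S.card = n - 1 := by
    rw [Finset.card_erase_of_mem (Finset.mem_univ _), Finset.card_univ, Fintype.card_fin]
  let w : Fin n → κ ⊕ Fin n → ℕ := fun i => Pi.single (Sum.inr i) 1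
  let F : (κ ⊕ Fin n → ℕ) → ℤ := mixedDiff 1 S w (colength a c)
  let e : κ → κ ⊕ Fin n → ℕ := fun x => Pi.single (Sum.inl x) 1
  have hF : ∀ p q : κ ⊕ Fin n → ℕ, powerIdeal a c p ⊆ powerIdeal a c q →
      ∃ (m : ℕ) (K : κ ⊕ Fin n → ℕ), ∀ k ≥ K, F (k + p) - F (k + q) = m := by
    intro p q hpq
    obtain ⟨m, K, h⟩ := mixedDiff_colength_sub_eventually_const hR i₀ hpq S hS Sum.inr
    refine ⟨m, K, fun k hk => ?_⟩
    rw [← h k hk, mixedDiff_sub, mixedDiff_shift 1 S _ (colength a c) p,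
      mixedDiff_shift 1 S _ (colength a c) q]
  have hone : powerIdeal a c 0 = Set.univ := by
    refine Set.eq_univ_of_forall fun x => ⟨0, ?_, ?_⟩
    · ext i
      simp [colorDeg]
    · simp [weight]
  choose m K hm using fun x => hF (e x) 0 (by rw [hone]; exact Set.subset_univ _)
  simp only [add_zero] at hm
  refine ⟨m, fun x => ?_, fun x y hxy => ?_, fun x y y' hxy => ?_⟩
  · have hvol := relMixedVolume_newtonPolyhedron hR i₀
      (Function.update (Sum.inr : Fin n → κ ⊕ Fin n) i₀ (Sum.inl x)) (m := m x) (K := K x) (by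
      intro k hk
      rw [← Finset.insert_erase (Finset.mem_univ i₀), mixedDiff_insert 1 (Finset.notMem_erase _ _),
        mixedDiff_sub, mixedDiff_shift, ← hm x k hk]
      have hw : ∀ i ∈ Finset.univ.erase i₀, (Pi.single (Function.update
          (Sum.inr : Fin n → κ ⊕ Fin n) i₀ (Sum.inl x) i) 1 : κ ⊕ Fin n → ℕ) = w i := by
        intro i hi
        rw [Function.update_of_ne (Finset.ne_of_mem_erase hi)]
      rw [mixedDiff_congr 1 _ hw, mixedDiff_congr 1 _ hw, Function.update_self, one_smul])
    rw [Int.cast_natCast] at hvol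
    rw [← hvol]
    congr 1
    ext1 i
    by_cases hi : i = i₀
    · subst hi
      simp [hgen]
    · simp [hi, hgen]
  · obtain ⟨m', K', h'⟩ := hF (e x) (e y) (by
      intro z hz
      obtain ⟨g, hg, hgz⟩ := mem_powerIdeal_single.1 hz
      rw [hgen] at hg
      obtain ⟨g', hg', hle⟩ := hxy g hg
      exact mem_powerIdeal_single.2 ⟨g', by rw [hgen]; exact hg', hle.trans hgz⟩)
    set k := K' ⊔ K x ⊔ K y
    have h1 := h' k (le_sup_left.trans le_sup_left)
    have h2 := hm x k (le_sup_right.trans le_sup_left)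
    have h3 := hm y k le_sup_right
    omega
  · obtain ⟨m', K', h'⟩ := hF (e x + e x) (e y + e y') (by
      intro z hz
      obtain ⟨u, hu, α, hα, rfl⟩ := mem_powerIdeal_add_iff.1 hz
      have hw : weight a α ∈ powerIdeal a c (e x) := hα ▸ weight_mem_powerIdeal α
      obtain ⟨g₁, hg₁, hle₁⟩ := mem_powerIdeal_single.1 hu
      obtain ⟨g₂, hg₂, hle₂⟩ := mem_powerIdeal_single.1 hw
      rw [hgen] at hg₁ hg₂
      obtain ⟨g, hg, g', hg', hle⟩ := hxy g₁ hg₁ g₂ hg₂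
      exact isUpperSet_powerIdeal _ (hle.trans (add_le_add hle₁ hle₂)) (add_mem_powerIdeal
        (mem_powerIdeal_single.2 ⟨g, by rw [hgen]; exact hg, le_rfl⟩)
        (mem_powerIdeal_single.2 ⟨g', by rw [hgen]; exact hg', le_rfl⟩)))
    set k := K' ⊔ K x ⊔ K y ⊔ K y' with hk
    have hk' : K' ≤ k := le_sup_left.trans (le_sup_left.trans le_sup_left)
    have hkx : K x ≤ k := le_sup_right.trans (le_sup_left.trans le_sup_left)
    have hky : K y ≤ k := le_sup_right.trans le_sup_left
    have hky' : K y' ≤ k := le_sup_right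
    have h1 := h' k hk'
    have h2 := hm x k hkx
    have h3 := hm x (k + e x) (hkx.trans le_self_add)
    have h4 := hm y k hky
    have h5 := hm y' (k + e y) (hky'.trans le_self_add)
    rw [← add_assoc, ← add_assoc] at h1
    omega

end core

/-! ### Lattice polyhedra at bounded distance from the orthant -/

section polyhedra

variable {n : ℕ}

theorem IsPolyhedron.isClosed {B : Set (Fin n → ℝ)} (hB : IsPolyhedron B) : IsClosed B := by
  obtain ⟨m, f, b, rfl⟩ := hB
  rw [Set.ofPred_forall]
  exact isClosed_iInter fun j =>
    isClosed_le continuous_const (f j).continuous_of_finiteDimensional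

theorem IsPolyhedron.convex {B : Set (Fin n → ℝ)} (hB : IsPolyhedron B) : Convex ℝ B := by
  obtain ⟨m, f, b, rfl⟩ := hB
  rw [Set.ofPred_forall]
  exact convex_iInter fun j => convex_halfSpace_ge (f j).isLinear (b j)

theorem exists_forall_orthant_mem {B : Set (Fin n → ℝ)}
    (hB : Bornology.IsBounded (symmDiff (orthant n) B)) :
    ∃ M : ℕ, ∀ x ∈ orthant n, ∀ j, (M : ℝ) ≤ x j → x ∈ B := by
  obtain ⟨r, hr⟩ := hB.subset_closedBall 0
  obtain ⟨M, hM⟩ := exists_nat_gt r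
  refine ⟨M, fun x hx j hj => ?_⟩
  by_contra hxB
  have h1 := hr (Or.inl ⟨hx, hxB⟩)
  rw [mem_closedBall_zero_iff] at h1
  have h2 := norm_le_pi_norm x j
  rw [Real.norm_eq_abs] at h2
  linarith [le_abs_self (x j)]

/-- The orthant is contained in the recession cone of `B`. -/
theorem add_mem_of_isClosed {B : Set (Fin n → ℝ)} (hclosed : IsClosed B) (hconv : Convex ℝ B)
    {M : ℕ} (hM : ∀ x ∈ orthant n, ∀ j, (M : ℝ) ≤ x j → x ∈ B) (j₀ : Fin n) {p v : Fin n → ℝ}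
    (hp : p ∈ B) (hv : v ∈ orthant n) : p + v ∈ B := by
  have hmem : ∀ s : ℕ, 1 ≤ s →
      (1 - 1 / (s : ℝ)) • p + (1 / (s : ℝ)) • ((s : ℝ) • v + fun _ => (M : ℝ)) ∈ B := by
    intro s hs
    have hs' : (1 : ℝ) ≤ s := by exact_mod_cast hs
    have hle : 1 / (s : ℝ) ≤ 1 := by rw [div_le_one (by positivity)]; exact hs'
    refine hconv hp (hM _ (fun j => ?_) j₀ ?_) (sub_nonneg.2 hle) (by positivity) (by ring)
    · have := hv j
      simp only [Pi.add_apply, Pi.smul_apply, smul_eq_mul]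
      positivity
    · have := mul_nonneg (Nat.cast_nonneg (α := ℝ) s) (hv j₀)
      simpa using this
  have hlim : Filter.Tendsto (fun s : ℕ => (1 - 1 / (s : ℝ)) • p +
      (v + (1 / (s : ℝ)) • fun _ => (M : ℝ))) Filter.atTop
      (nhds ((1 - 0 : ℝ) • p + (v + (0 : ℝ) • fun _ => (M : ℝ)))) := by
    have h0 : Filter.Tendsto (fun s : ℕ => 1 / (s : ℝ)) Filter.atTop (nhds 0) :=
      tendsto_const_div_atTop_nhds_zero_nat 1
    exact ((tendsto_const_nhds.sub h0).smul_const p).add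
      (tendsto_const_nhds.add (h0.smul_const _))
  rw [sub_zero, one_smul, zero_smul, add_zero] at hlim
  refine hclosed.mem_of_tendsto hlim (Filter.eventually_atTop.2 ⟨1, fun s hs => ?_⟩)
  have hs' : (s : ℝ) ≠ 0 := by positivity
  have := hmem s hs
  rwa [smul_add, smul_smul, one_div, inv_mul_cancel₀ hs', one_smul, ← one_div] at this

/-- In dimension at least two a point `p` of `B` outside of the orthant would give an unbounded
ray of such points. -/
theorem subset_orthant_or {B : Set (Fin n → ℝ)}
    (hB : Bornology.IsBounded (symmDiff (orthant n) B))
    (hadd : ∀ p ∈ B, ∀ v ∈ orthant n, p + v ∈ B) :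
    B ⊆ orthant n ∨ (Subsingleton (Fin n) ∧ orthant n ⊆ B) := by
  by_contra! h
  obtain ⟨h1, h2⟩ := h
  obtain ⟨p, hp, hpC⟩ := Set.not_subset.1 h1
  obtain ⟨j, hj⟩ : ∃ j, p j < 0 := by
    by_contra! h'
    exact hpC h'
  by_cases hsub : Subsingleton (Fin n)
  · refine h2 hsub fun x hx => ?_
    have := hadd p hp (x - p) fun i => by
      have := hx i
      rw [Subsingleton.elim i j] at *
      simp only [Pi.sub_apply]
      linarith
    simpa using this
  · obtain ⟨k, hk⟩ : ∃ k, k ≠ j := by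
      by_contra! h'
      exact hsub ⟨fun a b => (h' a).trans (h' b).symm⟩
    obtain ⟨r, hr⟩ := hB.subset_closedBall 0
    have hmem := hadd p hp (Pi.single k (|p k| + |r| + 1)) fun i => by
      by_cases hi : i = k
      · subst hi
        simp only [Pi.single_eq_same]
        positivity
      · simp [hi]
    have hnot : p + Pi.single k (|p k| + |r| + 1) ∉ orthant n := fun h' => by
      have := h' j
      simp only [Pi.add_apply, Pi.single_eq_of_ne hk.symm, add_zero] at this
      linarith
    have h3 := hr (Or.inr ⟨hmem, hnot⟩)
    rw [mem_closedBall_zero_iff] at h3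
    have h4 := norm_le_pi_norm (p + Pi.single k (|p k| + |r| + 1)) k
    simp only [Real.norm_eq_abs, Pi.add_apply, Pi.single_eq_same] at h4
    have h5 := le_abs_self (p k + (|p k| + |r| + 1))
    have h6 := neg_abs_le (p k)
    have h7 := le_abs_self r
    linarith

theorem isClosed_newtonPolyhedron {A : Set (Fin n → ℕ)} (hA : A.Finite) :
    IsClosed (newtonPolyhedron A) :=
  IsClosed.add_left_of_isCompact (t := orthant n) (isClosed_Ici (a := (0 : Fin n → ℝ)))
    ((hA.image toReal).isCompact_convexHull ℝ)

theorem convex_newtonPolyhedron (A : Set (Fin n → ℕ)) : Convex ℝ (newtonPolyhedron A) :=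
  (convex_convexHull ℝ _).add (convex_orthant n)

theorem add_mem_newtonPolyhedron {A : Set (Fin n → ℕ)} {x v : Fin n → ℝ}
    (hx : x ∈ newtonPolyhedron A) (hv : v ∈ orthant n) : x + v ∈ newtonPolyhedron A := by
  obtain ⟨y, hy, hle⟩ := mem_newtonPolyhedron.1 hx
  exact mem_newtonPolyhedron.2 ⟨y, hy, hle.trans (le_add_of_nonneg_right hv)⟩

theorem exists_toReal_eq {x : Fin n → ℝ} (hx : x ∈ orthant n) (hlat : IsLatticePoint x) :
    ∃ z, toReal z = x := by
  choose z hz using hlat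
  refine ⟨fun i => (z i).toNat, funext fun i => ?_⟩
  have h0 : 0 ≤ z i := by
    have := hx i
    rw [hz] at this
    exact_mod_cast this
  rw [hz, toReal]
  exact_mod_cast Int.toNat_of_nonneg h0

/-- A closed subset of the orthant which contains a point `x` contains an extreme point `z` with
`g z ≤ g x`, for every linear function `g` that is strictly positive on the orthant. -/
theorem exists_extremePoint_le {B : Set (Fin n → ℝ)} (hclosed : IsClosed B)
    (hBC : B ⊆ orthant n) (g : StrongDual ℝ (Fin n → ℝ)) {ε : ℝ} (hε : 0 < ε)
    (hg : ∀ v ∈ orthant n, ε * ∑ j, v j ≤ g v) {x : Fin n → ℝ} (hx : x ∈ B) :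
    ∃ z ∈ B.extremePoints ℝ, g z ≤ g x := by
  have hcomp : ∀ s : ℝ, IsCompact (B ∩ {y | g y ≤ s}) := by
    intro s
    refine (isCompact_Icc (a := (0 : Fin n → ℝ)) (b := fun _ => s / ε)).of_isClosed_subset
      (hclosed.inter (isClosed_le g.continuous continuous_const)) ?_
    rintro y ⟨hyB, hys⟩
    have hy := hBC hyB
    refine ⟨hy, fun j => ?_⟩
    have h1 := Finset.single_le_sum (f := y) (fun j _ => hy j) (Finset.mem_univ j)
    rw [le_div_iff₀ hε, mul_comm]
    exact (mul_le_mul_of_nonneg_left h1 hε.le).trans ((hg y hy).trans hys)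
  obtain ⟨y, ⟨hyB, hyx⟩, hmin⟩ := (hcomp (g x)).exists_isMinOn ⟨x, hx, le_refl (g x)⟩
    g.continuous.continuousOn
  have hmin' : ∀ w ∈ B, g y ≤ g w := fun w hw => by
    by_cases h : g w ≤ g x
    · exact hmin ⟨hw, h⟩
    · exact le_trans hyx (not_le.1 h).le
  obtain ⟨z, hz⟩ := (hcomp (g y)).extremePoints_nonempty ⟨y, hyB, le_refl (g y)⟩
  refine ⟨z, ?_, hz.1.2.trans hyx⟩
  have hexp : IsExposed ℝ B (B ∩ {w | g w ≤ g y}) := by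
    intro _
    refine ⟨-g, ?_⟩
    ext w
    constructor
    · rintro ⟨hw, hle⟩
      exact ⟨hw, fun u hu => neg_le_neg (le_trans hle (hmin' u hu))⟩
    · rintro ⟨hw, hle⟩
      exact ⟨hw, neg_le_neg_iff.1 (hle y hyB)⟩
  exact hexp.isExtreme.extremePoints_subset_extremePoints hz

/-- A lattice polyhedron `B` in the orthant with bounded complement is the Newton polyhedron of a
finite set of exponents. A point of `B` outside this Newton polyhedron could be separated from it
by a linear function that is strictly positive on the orthant; the minimum of this function on `B`
would be attained at a vertex of `B`. -/
theorem exists_eq_newtonPolyhedron {B : Set (Fin n → ℝ)} (hB : IsLatticePolyhedron B)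
    (hBC : B ⊆ orthant n) {M : ℕ} (hM : ∀ x ∈ orthant n, ∀ j, (M : ℝ) ≤ x j → x ∈ B)
    (j₀ : Fin n) : ∃ A : Set (Fin n → ℕ), IsAxial A ∧ B = newtonPolyhedron A := by
  have hclosed := hB.1.isClosed
  have hconv := hB.1.convex
  let A : Set (Fin n → ℕ) := {z | toReal z ∈ B ∧ z ≤ fun _ => M}
  have haxis : ∀ j, Pi.single j M ∈ A := fun j =>
    ⟨hM _ (toReal_nonneg _) j (by simp [toReal]), fun i => by
      by_cases hi : i = j
      · subst hi; simp
      · simp [hi]⟩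
  have hA : IsAxial A := ⟨(Set.finite_Iic (fun _ => M)).subset fun z hz => hz.2,
    fun j => ⟨M, haxis j⟩⟩
  have hsubset : newtonPolyhedron A ⊆ B := by
    rintro _ ⟨y, hy, v, hv, rfl⟩
    refine add_mem_of_isClosed hclosed hconv hM j₀ (convexHull_min ?_ hconv hy) hv
    rintro _ ⟨z, hz, rfl⟩
    exact hz.1
  have hlattice : ∀ z, toReal z ∈ B → toReal z ∈ newtonPolyhedron A := by
    intro z hz
    by_cases hle : z ≤ fun _ => M
    · exact mem_newtonPolyhedron.2 ⟨_, subset_convexHull ℝ _ ⟨z, ⟨hz, hle⟩, rfl⟩, le_rfl⟩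
    · obtain ⟨j, hj⟩ : ∃ j, M < z j := by
        by_contra! h
        exact hle h
      exact mem_newtonPolyhedron.2 ⟨_, subset_convexHull ℝ _ ⟨_, haxis j, rfl⟩,
        toReal_le_toReal.2 (single_le_of_le_apply hj.le)⟩
  refine ⟨A, hA, Set.Subset.antisymm (fun x hx => ?_) hsubset⟩
  by_contra hxE
  obtain ⟨f, u, hfx, hfE⟩ := geometric_hahn_banach_point_closed (convex_newtonPolyhedron A)
    (isClosed_newtonPolyhedron hA.finite) hxE
  have hf0 : ∀ v ∈ orthant n, 0 ≤ f v := by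
    intro v hv
    by_contra! hneg
    have hb := mem_newtonPolyhedron.2 ⟨_, subset_convexHull ℝ _ ⟨_, haxis j₀, rfl⟩, le_rfl⟩
    set b := toReal (Pi.single j₀ M) with hbdef
    have hub := hfE b hb
    have hs : 0 ≤ (f b - u) / (-f v) := div_nonneg (by linarith) (by linarith)
    have h2 := hfE _ (add_mem_newtonPolyhedron hb (v := ((f b - u) / (-f v)) • v)
      (mem_orthant.2 (smul_nonneg hs hv)))
    have h3 : (f b - u) / (-f v) * f v = u - f b := by
      rw [div_neg, neg_mul, div_mul_cancel₀ _ hneg.ne, neg_sub]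
    rw [map_add, map_smul, smul_eq_mul, h3] at h2
    linarith
  have hxs : 0 ≤ ∑ j, x j := Finset.sum_nonneg fun j _ => hBC hx j
  set ε := (u - f x) / (∑ j, x j + 1) with hεdef
  have hε : 0 < ε := div_pos (by linarith) (by linarith)
  let g : StrongDual ℝ (Fin n → ℝ) := f + ε • ∑ j, ContinuousLinearMap.proj (R := ℝ) j
  have hgv : ∀ v, g v = f v + ε * ∑ j, v j := fun v => by simp [g]
  have hgx : g x < u := by
    have : ε * (∑ j, x j + 1) = u - f x := div_mul_cancel₀ _ (by linarith)
    rw [hgv]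
    linarith
  obtain ⟨z, hz, hzx⟩ := exists_extremePoint_le hclosed hBC g hε
    (fun v hv => by rw [hgv]; linarith [hf0 v hv]) hx
  obtain ⟨z', rfl⟩ := exists_toReal_eq (hBC hz.1) (hB.2 z hz)
  have h1 := hfE _ (hlattice z' hz.1)
  have h2 : 0 ≤ ε * ∑ j, toReal z' j :=
    mul_nonneg hε.le (Finset.sum_nonneg fun j _ => toReal_nonneg z' j)
  rw [hgv (toReal z')] at hzx
  linarith

theorem convexHull_newtonPolyhedron_union {A : Set (Fin n → ℕ)} {M : ℕ}
    (hM : ∀ x ∈ orthant n, ∀ j, (M : ℝ) ≤ x j → x ∈ newtonPolyhedron A) (d : Fin n → ℕ) :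
    convexHull ℝ (newtonPolyhedron A ∪ {toReal d}) = newtonPolyhedron (A ∪ {d}) := by
  refine Set.Subset.antisymm (convexHull_min ?_ (convex_newtonPolyhedron _)) ?_
  · rintro x (hx | rfl)
    · obtain ⟨y, hy, hle⟩ := mem_newtonPolyhedron.1 hx
      exact mem_newtonPolyhedron.2
        ⟨y, convexHull_mono (Set.image_mono Set.subset_union_left) hy, hle⟩
    · exact mem_newtonPolyhedron.2 ⟨_, subset_convexHull ℝ _ ⟨d, Or.inr rfl, rfl⟩, le_rfl⟩
  · rintro _ ⟨y, hy, v, hv, rfl⟩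
    have hyH : y ∈ convexHull ℝ (newtonPolyhedron A ∪ {toReal d}) := by
      refine convexHull_min ?_ (convex_convexHull ℝ _) hy
      rintro _ ⟨z, hz | rfl, rfl⟩
      · exact subset_convexHull ℝ _ (Or.inl (mem_newtonPolyhedron.2
          ⟨_, subset_convexHull ℝ _ ⟨z, hz, rfl⟩, le_rfl⟩))
      · exact subset_convexHull ℝ _ (Or.inr rfl)
    have hy0 := nonneg_of_mem_convexHull_toReal hy
    by_cases hv0 : v = 0
    · simpa [hv0] using hyH
    obtain ⟨j, hj⟩ := Function.ne_iff.1 hv0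
    have hjpos : 0 < v j := lt_of_le_of_ne (hv j) (Ne.symm hj)
    -- `y + v` lies on the segment from `y` to a far point `y + s • v` of the Newton polyhedron
    set s : ℝ := M / v j + 1 with hs
    have hs1 : 1 ≤ s := le_add_of_nonneg_left (by positivity)
    have hsv : (M : ℝ) ≤ (y + s • v) j := by
      have h1 := hy0 j
      have h2 : M / v j * v j = M := div_mul_cancel₀ _ hjpos.ne'
      simp only [Pi.add_apply, Pi.smul_apply, smul_eq_mul, hs, add_mul, h2]
      simp only [Pi.zero_apply] at h1
      linarith
    have hfar : y + s • v ∈ newtonPolyhedron A := hM _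
      (mem_orthant.2 (add_nonneg hy0 (smul_nonneg (by linarith) hv))) j hsv
    have hs0 : s ≠ 0 := by linarith
    have := convex_convexHull ℝ (newtonPolyhedron A ∪ {toReal d}) hyH
      (subset_convexHull ℝ _ (Or.inl hfar)) (a := 1 - s⁻¹) (b := s⁻¹)
      (sub_nonneg.2 (inv_le_one_of_one_le₀ hs1)) (by positivity) (by ring)
    convert this using 1
    rw [smul_add, smul_smul, inv_mul_cancel₀ hs0, one_smul, ← add_assoc, ← add_smul,
      sub_add_cancel, one_smul]

end polyhedra

/-! ### Minimal tuples -/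

/-- A nondecreasing concave sequence of natural numbers with limit `v` strictly increases until
it reaches `v`, hence has reached it after `v` steps. -/
theorem apply_limit_eq_of_concave {c : ℕ → ℕ} (hmono : ∀ k, c k ≤ c (k + 1))
    (hconc : ∀ k, c k + c (k + 2) ≤ 2 * c (k + 1)) {v L : ℕ} (hL : ∀ k ≥ L, c k = v) :
    c v = v := by
  have hle : ∀ k, c k ≤ v := fun k => by
    rw [← hL (max k L) (le_max_right _ _)]
    exact monotone_nat_of_le_succ hmono (le_max_left _ _)
  have hstable : ∀ k, c (k + 1) = c k → c k = v := by
    intro k hk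
    have : ∀ j, c (k + j + 1) = c (k + j) ∧ c (k + j) = c k := by
      intro j
      induction j with
      | zero => exact ⟨hk, rfl⟩
      | succ j ih =>
        have h1 := hconc (k + j)
        have h2 := hmono (k + j + 1)
        simp only [← add_assoc]
        refine ⟨?_, ih.1.trans ih.2⟩
        have h3 : c (k + j + 2) = c (k + j + 1 + 1) := rfl
        omega
    rw [← (this L).2]
    exact hL _ le_add_self
  have hlow : ∀ k, min k v ≤ c k := by
    intro k
    induction k with
    | zero => simp
    | succ k ih =>
      have h1 := hmono k
      by_cases h : c (k + 1) = c k
      · have := hstable k h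
        omega
      · omega
  exact le_antisymm (hle v) (by simpa using hlow v)

section minimal

variable {n : ℕ}

theorem exists_le_sum_eq {z : Fin n → ℕ} {v : ℕ} (h : v ≤ ∑ j, z j) :
    ∃ g ≤ z, ∑ j, g j = v := by
  obtain ⟨g, hg, he⟩ := exists_le_colorDeg_eq (c := fun _ : Fin n => ()) z (fun _ => v)
    (fun _ => by simpa [colorDeg] using h)
  exact ⟨g, hg, by simpa [colorDeg] using congrFun he ()⟩

theorem finite_sum_eq (n k : ℕ) : {z : Fin n → ℕ | ∑ j, z j = k}.Finite := by
  refine (Set.finite_Iic (fun _ => k)).subset ?_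
  rintro z rfl j
  exact Finset.single_le_sum (fun _ _ => Nat.zero_le _) (Finset.mem_univ j)

/-- The generators of the sum of the ideal generated by `A` and the `k`-th power of the maximal
ideal. -/
def addDegree (A : Set (Fin n → ℕ)) (k : ℕ) : Set (Fin n → ℕ) := A ∪ {z | ∑ j, z j = k}

theorem IsAxial.union {A D : Set (Fin n → ℕ)} (hA : IsAxial A) (hD : D.Finite) :
    IsAxial (A ∪ D) :=
  ⟨hA.finite.union hD, fun j => (hA.axis j).imp fun _ h => Or.inl h⟩

/-- All monomials of large degree lie in the ideal generated by an axial set. -/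
theorem IsAxial.exists_le {A : Set (Fin n → ℕ)} (hA : IsAxial A) (j₀ : Fin n) :
    ∃ L, ∀ z : Fin n → ℕ, L ≤ ∑ j, z j → ∃ g ∈ A, g ≤ z := by
  choose r hr using hA.axis
  refine ⟨∑ j, r j, fun z hz => ?_⟩
  obtain ⟨j, -, hj⟩ := Finset.exists_le_of_sum_le ⟨j₀, Finset.mem_univ j₀⟩ hz
  exact ⟨_, hr j, single_le_of_le_apply hj⟩

/-- The square of `I + 𝔪 ^ (k + 1)` is contained in the product of `I + 𝔪 ^ k` and
`I + 𝔪 ^ (k + 2)`, where `I` is generated by `A`. -/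
theorem exists_add_le_of_addDegree (A : Set (Fin n → ℕ)) (k : ℕ) :
    ∀ z ∈ addDegree A (k + 1), ∀ z' ∈ addDegree A (k + 1),
      ∃ g ∈ addDegree A k, ∃ g' ∈ addDegree A (k + 2), g + g' ≤ z + z' := by
  have hdrop : ∀ z : Fin n → ℕ, ∑ j, z j = k + 1 →
      ∃ (y : Fin n → ℕ) (j : Fin n), ∑ j, y j = k ∧ z = y + Pi.single j 1 := by
    intro z hz
    obtain ⟨j, -, hj⟩ := Finset.exists_ne_zero_of_sum_ne_zero (show ∑ j, z j ≠ 0 by omega)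
    obtain ⟨y, hy⟩ := exists_add_of_le
      (single_le_of_le_apply (Nat.one_le_iff_ne_zero.2 hj) : Pi.single j 1 ≤ z)
    refine ⟨y, j, ?_, by rw [hy, add_comm]⟩
    rw [hy] at hz
    simp only [Pi.add_apply, Finset.sum_add_distrib, Finset.sum_pi_single', Finset.mem_univ,
      if_true] at hz
    omega
  rintro z (hz | hz) z' (hz' | hz')
  · exact ⟨z, Or.inl hz, z', Or.inl hz', le_rfl⟩
  · obtain ⟨y, j, hy, rfl⟩ := hdrop z' hz'
    exact ⟨y, Or.inr hy, z, Or.inl hz, by rw [add_comm z]; exact add_le_add le_self_add le_rfl⟩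
  · obtain ⟨y, j, hy, rfl⟩ := hdrop z hz
    exact ⟨y, Or.inr hy, z', Or.inl hz', add_le_add le_self_add le_rfl⟩
  · obtain ⟨y, j, hy, rfl⟩ := hdrop z hz
    refine ⟨y, Or.inr hy, z' + Pi.single j 1, Or.inr ?_, by
      rw [add_assoc, add_comm z']⟩
    have hz'' : ∑ j, z' j = k + 1 := hz'
    simp only [Set.mem_ofPred_eq, Pi.add_apply, Finset.sum_add_distrib, hz'',
      Finset.sum_pi_single', Finset.mem_univ, if_true]

/-- The relative mixed volume `v` does not drop when a lattice point with coordinate sum at least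
`v` is added to one member of the tuple. Indeed, it does not drop even when all monomials of degree
`v` are added to the ideal, since after adding those of degree `k` it is a concave function
of `k`. -/
theorem exists_relMixedVolume_eq_and_le_update_union {A : Fin n → Set (Fin n → ℕ)} (hA : ∀ i, IsAxial (A i))
    (i₀ : Fin n) : ∃ v : ℕ, relMixedVolume (fun i => newtonPolyhedron (A i)) = v ∧
      ∀ d : Fin n → ℕ, v ≤ ∑ j, d j → (v : ℝ) ≤ relMixedVolume
        (Function.update (fun i => newtonPolyhedron (A i)) i₀
          (newtonPolyhedron (A i₀ ∪ {d}))) := by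
  let vol : Set (Fin n → ℕ) → ℝ := fun X => relMixedVolume
    (Function.update (fun i => newtonPolyhedron (A i)) i₀ (newtonPolyhedron X))
  have hnat : ∀ X, IsAxial X → ∃ m : ℕ, vol X = m := by
    intro X hX
    obtain ⟨m, hm, -⟩ := exists_relMixedVolume_eq (X := fun _ : Unit => X) (fun _ => hX) hA i₀
    exact ⟨m (), hm ()⟩
  have hanti : ∀ X Y, IsAxial X → IsAxial Y → (∀ z ∈ X, ∃ g ∈ Y, g ≤ z) → vol Y ≤ vol X := by
    intro X Y hX hY h
    obtain ⟨m, hm, hle, -⟩ := exists_relMixedVolume_eq (X := ![X, Y])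
      (by simp [Fin.forall_fin_two, hX, hY]) hA i₀
    have h0 : vol X = m 0 := hm 0
    have h1 : vol Y = m 1 := hm 1
    rw [h0, h1]
    exact_mod_cast hle 0 1 h
  have hconc : ∀ X Y Y', IsAxial X → IsAxial Y → IsAxial Y' →
      (∀ z ∈ X, ∀ z' ∈ X, ∃ g ∈ Y, ∃ g' ∈ Y', g + g' ≤ z + z') →
      vol Y + vol Y' ≤ 2 * vol X := by
    intro X Y Y' hX hY hY' h
    obtain ⟨m, hm, -, hle⟩ := exists_relMixedVolume_eq (X := ![X, Y, Y'])
      (by simp [Fin.forall_fin_succ, hX, hY, hY']) hA i₀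
    have h0 : vol X = m 0 := hm 0
    have h1 : vol Y = m 1 := hm 1
    have h2 : vol Y' = m 2 := hm 2
    rw [h0, h1, h2]
    exact_mod_cast hle 0 1 2 h
  have hax : ∀ k, IsAxial (addDegree (A i₀) k) := fun k => (hA i₀).union (finite_sum_eq n k)
  obtain ⟨v, hv⟩ := hnat (A i₀) (hA i₀)
  choose m hm using fun k => hnat _ (hax k)
  obtain ⟨L, hL⟩ := (hA i₀).exists_le i₀
  have hmv : m v = v := by
    refine apply_limit_eq_of_concave (L := L) (fun k => ?_) (fun k => ?_) fun k hk => ?_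
    · have := hanti _ _ (hax (k + 1)) (hax k) (by
        rintro z (hz | hz)
        · exact ⟨z, Or.inl hz, le_rfl⟩
        · obtain ⟨g, hg, hs⟩ := exists_le_sum_eq (z := z) (v := k)
            (le_trans (Nat.le_succ k) (le_of_eq hz.symm))
          exact ⟨g, Or.inr hs, hg⟩)
      rw [hm, hm] at this
      exact_mod_cast this
    · have := hconc _ _ _ (hax (k + 1)) (hax k) (hax (k + 2))
        (exists_add_le_of_addDegree (A i₀) k)
      rw [hm, hm, hm] at this
      exact_mod_cast this
    · have h1 := hanti _ _ (hA i₀) (hax k) fun z hz => ⟨z, Or.inl hz, le_rfl⟩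
      have h2 := hanti _ _ (hax k) (hA i₀) (by
        rintro z (hz | hz)
        · exact ⟨z, hz, le_rfl⟩
        · exact hL z (hk.trans (le_of_eq hz.symm)))
      rw [hm, hv] at h1 h2
      exact le_antisymm (by exact_mod_cast h1) (by exact_mod_cast h2)
  refine ⟨v, ?_, fun d hd => ?_⟩
  · rw [← hv]
    simp only [vol]
    rw [Function.update_eq_self i₀ (fun i => newtonPolyhedron (A i))]
  · have h1 := hanti _ _ ((hA i₀).union (Set.finite_singleton d)) (hax v) (by
      rintro z (hz | rfl)
      · exact ⟨z, Or.inl hz, le_rfl⟩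
      · obtain ⟨g, hg, hs⟩ := exists_le_sum_eq hd
        exact ⟨g, Or.inr hs, hg⟩)
    rwa [hm, hmv] at h1

theorem cutOrthant_subset {B : Set (Fin n → ℝ)} (hconv : Convex ℝ B)
    (hadd : ∀ p ∈ B, ∀ u ∈ orthant n, p + u ∈ B) {v : ℕ} (j₀ : Fin n)
    (hv : ∀ j, toReal (Pi.single j v) ∈ B) : cutOrthant n v ⊆ B := by
  rintro x ⟨hx, hsum⟩
  rcases Nat.eq_zero_or_pos v with rfl | hpos
  · have h0 : toReal (Pi.single j₀ 0 : Fin n → ℕ) = 0 := by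
      ext i
      simp [toReal]
    have := hadd _ (hv j₀) x hx
    rwa [h0, zero_add] at this
  · have hpos' : (0 : ℝ) < v := by exact_mod_cast hpos
    set s := ∑ i, x i with hs
    have hs0 : 0 < s := hpos'.trans_le hsum
    have hmem : ∑ j, (x j / s) • toReal (Pi.single j v) ∈ B :=
      hconv.sum_mem (fun j _ => div_nonneg (hx j) hs0.le)
        (by rw [← Finset.sum_div, ← hs, div_self hs0.ne']) fun j _ => hv j
    have hle : ∑ j, (x j / s) • toReal (Pi.single j v) ≤ x := by
      intro i
      rw [Finset.sum_apply, Finset.sum_eq_single i]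
      · simp only [Pi.smul_apply, toReal, Pi.single_eq_same, smul_eq_mul]
        rw [div_mul_eq_mul_div, div_le_iff₀ hs0]
        exact mul_le_mul_of_nonneg_left hsum (hx i)
      · intro j _ hj
        simp [toReal, hj.symm]
      · simp
    have := hadd _ hmem _ (mem_orthant.2 (sub_nonneg.2 hle))
    rwa [add_sub_cancel] at this

end minimal

end RelMixedVolume

theorem theorem5p1 (n : ℕ) (B : Fin n → Set (Fin n → ℝ)) (V : ℝ)
    (hpoly : ∀ i, RelMixedVolume.IsLatticePolyhedron (B i))
    (hbdd : ∀ i, Bornology.IsBounded (symmDiff (RelMixedVolume.orthant n) (B i)))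
    (hmin : RelMixedVolume.IsMinimalTuple B V) :
    ∀ i, RelMixedVolume.cutOrthant n V ⊆ B i := by
  intro i₀
  by_cases hCB : RelMixedVolume.orthant n ⊆ B i₀
  · exact fun x hx => hCB hx.1
  choose M hM using fun i => RelMixedVolume.exists_forall_orthant_mem (hbdd i)
  have hadd : ∀ i, ∀ p ∈ B i, ∀ v ∈ RelMixedVolume.orthant n, p + v ∈ B i := fun i p hp v hv =>
    RelMixedVolume.add_mem_of_isClosed (hpoly i).1.isClosed (hpoly i).1.convex (hM i) i₀ hp hv
  have hsub : ∀ i, B i ⊆ RelMixedVolume.orthant n := by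
    intro i
    rcases RelMixedVolume.subset_orthant_or (hbdd i) (hadd i) with h | ⟨h1, h2⟩
    · exact h
    · exact absurd (Subsingleton.elim i i₀ ▸ h2) hCB
  choose A hA hBA using fun i =>
    RelMixedVolume.exists_eq_newtonPolyhedron (hpoly i) (hsub i) (hM i) i₀
  obtain rfl : B = fun i => RelMixedVolume.newtonPolyhedron (A i) := funext hBA
  obtain ⟨hV, hlt⟩ := hmin
  obtain ⟨v, hv, hle⟩ := RelMixedVolume.exists_relMixedVolume_eq_and_le_update_union hA i₀
  obtain rfl : V = v := hV.symm.trans hv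
  refine RelMixedVolume.cutOrthant_subset (hpoly i₀).1.convex (hadd i₀) i₀ fun j => ?_
  by_contra hnot
  have h1 := hlt i₀ (RelMixedVolume.toReal (Pi.single j v))
    ⟨RelMixedVolume.toReal_nonneg _, hnot⟩ fun i => ⟨_, (Int.cast_natCast _).symm⟩
  rw [RelMixedVolume.convexHull_newtonPolyhedron_union (hM i₀)] at h1
  exact absurd h1 (not_lt.2 (hle _ (by simp)))
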